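/- Let $F=\begin{pmatrix}1&1&0\\1&2&0\\0&1&3\end{pmatrix}$ and let $B$ be the stationary Bratteli diagram with incidence matrix $F$: level $0$ has a single vertex $v_0$, each level $n\ge 1$ has three vertices $1,2,3$, there is exactly one edge from $v_0$ to each vertex of level $1$, and for $n\ge 1$ there are exactly $F_{vw}$ edges from the vertex $w$ of level $n$ to the vertex $v$ of level $n+1$. Let $X_B$ be the space of infinite paths starting at $v_0$, with the topology generated by the cylinder sets $U(e_1,\dots,e_m)$ of all paths with initial edges $e_1,\dots,e_m$ $(m \ge 1)$, and its Borel $\sigma$-algebra. Two paths are tail equivalent if they agree from some edge on. A measure on $X_B$ is invariant if any two cylinder sets given by finite paths (starting at $v_0$) with the same end vertex at the same level have equal measure; an invariant probability measure is ergodic if every Borel set that is saturated for tail equivalence is null or conull. A Borel measure $\mu$ on $X_B$ is said to be defined by an eigenvalue $\lambda$ of $F^T$ if there is a vector $\xi=(\xi_1,\xi_2,\xi_3)$ with $\xi_i\ge 0$, $\sum_i\xi_i=1$ and $F^T\xi=\lambda\xi$ such that $\mu(U(e_1,\dots,e_m))=\xi_i/\lambda^{m-1}$ for every finite path $(e_1,\dots,e_m)$,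 $m\ge1$, that starts at $v_0$ and ends at vertex $i$ of level $m$. For a full probability measure $\mu$ on a Cantor set $X$ (full: every non-empty clopen set has positive measure) let $S(\mu)=\{\mu(U): U\subset X \text{ clopen}\}$, and for a non-empty clopen set $U\subset X$ let $\mu_U(A)=\mu(A\cap U)/\mu(U)$ be the relative measure on $U$. The measure $\mu$ is of Bernoulli type if there is a collection $\mathcal B$ of non-empty clopen subsets of $X$ such that every non-empty clopen subset of $X$ is a disjoint union of finitely many members of $\mathcal B$, and $S(\mu_U)=S(\mu)$ for every $U\in\mathcal B$. A measure on $X_B$ is called of Bernoulli type if it is so when regarded as a full measure on its topological support. Then there is exactly one measure $\mu_1$ on $X_B$ defined by the eigenvalue $\lambda_1=\frac{3+\sqrt5}{2}$ and exactly one measure $\mu_2$ on $X_B$ defined by the eigenvalue $\lambda_2=3$; both are ergodic invariant probability measures; $\mu_1$ is of Bernoulli type, and $\mu_2$ is not of Bernoulli type. -/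

import Mathlib

open MeasureTheory

/-! ### Stationary Bratteli diagrams

The stationary Bratteli diagram with incidence matrix `F` has a single vertex at level `0`, a copy
of `Fin K` at every level `n ≥ 1`, exactly one edge from the vertex of level `0` to each vertex of
level `1`, and, for `n ≥ 1`, exactly `F v w` edges from the vertex `w` of level `n` to the vertex
`v` of level `n + 1`. -/

namespace Bratteli

/-- The edges between two consecutive levels `n` and `n + 1`, `n ≥ 1`: the edge `⟨v, w, i⟩` is the
`i`-th edge with range `v` and source `w`. -/
def Edge {K : ℕ} (F : Matrix (Fin K) (Fin K) ℕ) : Type :=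
  Σ v : Fin K, Σ w : Fin K, Fin (F v w)

/-- The finite set of edges is discrete. -/
instance {K : ℕ} (F : Matrix (Fin K) (Fin K) ℕ) : TopologicalSpace (Edge F) := ⊥

instance {K : ℕ} (F : Matrix (Fin K) (Fin K) ℕ) : DiscreteTopology (Edge F) := ⟨rfl⟩

/-- The range of an edge. -/
def Edge.range {K : ℕ} {F : Matrix (Fin K) (Fin K) ℕ} (e : Edge F) : Fin K := e.1

/-- The source of an edge. -/
def Edge.source {K : ℕ} {F : Matrix (Fin K) (Fin K) ℕ} (e : Edge F) : Fin K := e.2.1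

/-- The infinite paths starting at the vertex of level `0`.  The first edge of a path, which joins
the vertex of level `0` to a vertex of level `1`, is given by that vertex (the first component);
the second component lists the edges from level `n + 1` to level `n + 2`, for `n = 0, 1, 2, …`. -/
def PathSpace {K : ℕ} (F : Matrix (Fin K) (Fin K) ℕ) : Type :=
  {p : Fin K × (ℕ → Edge F) //
    Edge.source (p.2 0) = p.1 ∧ ∀ n, Edge.source (p.2 (n + 1)) = Edge.range (p.2 n)}

/-- The topology generated by the cylinder sets, i.e. the one induced by the product topology on
sequences of edges (the first edge of a path, from level `0`, is determined by the second one). -/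
instance {K : ℕ} (F : Matrix (Fin K) (Fin K) ℕ) : TopologicalSpace (PathSpace F) :=
  TopologicalSpace.induced (fun x : PathSpace F => x.1.2) inferInstance

/-- The path space carries its Borel σ-algebra. -/
instance {K : ℕ} (F : Matrix (Fin K) (Fin K) ℕ) : MeasurableSpace (PathSpace F) :=
  borel (PathSpace F)

instance {K : ℕ} (F : Matrix (Fin K) (Fin K) ℕ) : BorelSpace (PathSpace F) := ⟨rfl⟩

namespace PathSpace

variable {K : ℕ} {F : Matrix (Fin K) (Fin K) ℕ}

/-- The edge of a path from level `n + 1` to level `n + 2`. -/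
def edge (x : PathSpace F) (n : ℕ) : Edge F := x.1.2 n

/-- The vertex at level `n + 1` through which a path passes. -/
def vertex (x : PathSpace F) (n : ℕ) : Fin K := Edge.source (x.edge n)

/-- The cylinder set of all paths whose first `n + 1` edges are those of `x`; the finite path
consisting of these edges ends at the vertex `x.vertex n` of level `n + 1`. -/
def cylinder (x : PathSpace F) (n : ℕ) : Set (PathSpace F) :=
  {y | y.vertex 0 = x.vertex 0 ∧ ∀ k < n, y.edge k = x.edge k}

/-- Tail equivalence of paths. -/
def TailEquiv (x y : PathSpace F) : Prop := ∃ N, ∀ n ≥ N, x.edge n = y.edge n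

end PathSpace

/-- Invariance of a measure under the tail equivalence relation: two cylinder sets given by finite
paths with the same end vertex have equal measure. -/
def IsTailInvariant {K : ℕ} {F : Matrix (Fin K) (Fin K) ℕ} (μ : Measure (PathSpace F)) : Prop :=
  ∀ (x y : PathSpace F) (n : ℕ), x.vertex n = y.vertex n → μ (x.cylinder n) = μ (y.cylinder n)

/-- An ergodic invariant probability measure for the tail equivalence relation: every Borel set
which is saturated for tail equivalence is null or conull. -/
structure IsErgodicInvariant {K : ℕ} {F : Matrix (Fin K) (Fin K) ℕ}
    (μ : Measure (PathSpace F)) : Prop where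
  isProbabilityMeasure : IsProbabilityMeasure μ
  isTailInvariant : IsTailInvariant μ
  null_or_conull : ∀ A : Set (PathSpace F), MeasurableSet A →
    (∀ x y : PathSpace F, x.TailEquiv y → (x ∈ A ↔ y ∈ A)) → μ A = 0 ∨ μ Aᶜ = 0

/-- The measure `μ` on the path space is defined by the eigenvalue `lam` of `Fᵀ`: for some
probability eigenvector `ξ` of `Fᵀ` with eigenvalue `lam`, the cylinder set of every finite path
with `m = n + 1` edges that ends at the vertex `i` has measure `ξ i / lam ^ (m - 1)`. -/
def IsDefinedByEigenvalue {K : ℕ} {F : Matrix (Fin K) (Fin K) ℕ}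
    (lam : ℝ) (μ : Measure (PathSpace F)) : Prop :=
  ∃ ξ : Fin K → ℝ, (∀ i, 0 ≤ ξ i) ∧ ∑ i, ξ i = 1 ∧
    Matrix.mulVec (F.map (fun k : ℕ => (k : ℝ))).transpose ξ = lam • ξ ∧
    ∀ (x : PathSpace F) (n : ℕ), μ (x.cylinder n) = ENNReal.ofReal (ξ (x.vertex n) / lam ^ n)

end Bratteli

/-! ### Measures on Cantor sets -/

namespace CantorMeasure

/-- The clopen values set `S(μ) = {μ(U) : U clopen}`. -/
def clopenValues {X : Type*} [TopologicalSpace X] [MeasurableSpace X] (μ : Measure X) : Set ℝ :=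
  {r | ∃ U : Set X, IsClopen U ∧ r = μ.real U}

/-- The relative measure `A ↦ μ(A ∩ V) / μ(V)`, as a measure on the subspace `V`. -/
noncomputable def relative {X : Type*} [MeasurableSpace X] (μ : Measure X) (V : Set X) :
    Measure V :=
  (ProbabilityTheory.cond μ V).comap Subtype.val

/-- A partition basis: a collection of clopen sets such that every non-empty clopen set is a
disjoint union of (finitely many, by compactness) members of the collection. -/
def IsPartitionBasis {X : Type*} [TopologicalSpace X] (𝓑 : Set (Set X)) : Prop :=
  (∀ U ∈ 𝓑, IsClopen U) ∧
    ∀ U : Set X, IsClopen U → U.Nonempty →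
      ∃ P : Set (Set X), P ⊆ 𝓑 ∧ P.Finite ∧ P.PairwiseDisjoint id ∧ ⋃₀ P = U

/-- `U` is a clopen set of `μ` type: `U` is clopen and non-empty, and `S(μ_U) = S(μ)`. -/
def IsClopenOfType {X : Type*} [TopologicalSpace X] [MeasurableSpace X]
    (μ : Measure X) (U : Set X) : Prop :=
  IsClopen U ∧ U.Nonempty ∧ clopenValues (relative μ U) = clopenValues μ

/-- A (full) measure is of Bernoulli type when there is a partition basis consisting of clopen sets
of `μ` type. -/
def IsBernoulliType {X : Type*} [TopologicalSpace X] [MeasurableSpace X]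
    (μ : Measure X) : Prop :=
  ∃ 𝓑 : Set (Set X), IsPartitionBasis 𝓑 ∧ ∀ U ∈ 𝓑, IsClopenOfType μ U

/-- The measure `μ` considered as a (full) measure on its topological support. -/
noncomputable def onSupport {X : Type*} [TopologicalSpace X] [MeasurableSpace X]
    (μ : Measure X) : Measure μ.support :=
  μ.comap Subtype.val

end CantorMeasure

/-- The incidence matrix of the example. -/
def exampleMatrix : Matrix (Fin 3) (Fin 3) ℕ := !![1, 1, 0; 1, 2, 0; 0, 1, 3]

/-! ### Sums over edges, splicing of paths, cylinder sets -/

namespace Bratteli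

variable {K : ℕ} {F : Matrix (Fin K) (Fin K) ℕ}

/-! A probability eigenvector `ξ` defines a Markov measure (`exists_measure_of_eigenvector`), unique
because cylinder sets form a π-system. The eigenvectors here are `(2 - φ, φ - 1, 0)` for `1 + φ = (3
+ √5) / 2` and `(1/4, 1/2, 1/4)` for `3`.

Ergodicity: for a saturated Borel set `A`, the restriction `μ.restrict A` is again invariant and
lies below `μ`. Its cylinder vectors `a n` satisfy `a n = Fᵀ a (n + 1)` and are `O(lam⁻ⁿ)`. A left
eigenvector of `Fᵀ` with positive eigenvalue `θ < lam` must annihilate them (`eq_zero_of_decay`).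
With the null third coordinate in the golden case, this leaves only multiples of `ξ`, so the
restriction is `c • μ` and `A` is null or conull.

Bernoulli type: the clopen values of such a measure are closed under multiplication
(`IsBernoulliType.mul_mem`). For the eigenvalue `3` they all have the form `k / (4 * 3 ^ n)`; `1/4`
is a value but `1/16` is not of this form.

For the golden eigenvalue every cylinder set of positive measure has measure `φ⁻ᵐ`, a unit of
`ℤ[φ]`, and its relative clopen values are exactly `ℤ[φ] ∩ [0, 1]`. To realize a number, write it as
an integer combination of the coordinates of `ξ` and pass to deeper levels: the golden part of the
combination expands while its conjugate stays bounded, so the integer coefficients eventually become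
admissible numbers of subcylinders. -/

theorem sum_sigma_source (G : Fin K → Fin K → ℕ) (i : Fin K) (a : Fin K → ℝ) :
    ∑ e : (Σ v : Fin K, Σ w : Fin K, Fin (G v w)), (if e.2.1 = i then a e.1 else 0) =
      ∑ v, (G v i : ℝ) * a v := by
  rw [Fintype.sum_sigma]
  refine Finset.sum_congr rfl fun v _ => ?_
  rw [Fintype.sum_sigma]
  simp

abbrev fintypeSigma (G : Fin K → Fin K → ℕ) :
    Fintype (Σ v : Fin K, Σ w : Fin K, Fin (G v w)) :=
  inferInstance

instance (F : Matrix (Fin K) (Fin K) ℕ) : Fintype (Edge F) := fintypeSigma F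

/-- A sum over the edges with source `i` of a function of the range. -/
theorem sum_edge_source (i : Fin K) (a : Fin K → ℝ) :
    ∑ e : Edge F, (if e.source = i then a e.range else 0) = ∑ v, (F v i : ℝ) * a v :=
  sum_sigma_source F i a

/-- The chosen loop at a vertex. -/
def loopEdge (hF : ∀ v, 0 < F v v) (i : Fin K) : Edge F := ⟨i, i, ⟨0, hF i⟩⟩

@[simp]
theorem source_loopEdge (hF : ∀ v, 0 < F v v) (i : Fin K) : (loopEdge hF i).source = i := rfl

@[simp]
theorem range_loopEdge (hF : ∀ v, 0 < F v v) (i : Fin K) : (loopEdge hF i).range = i := rfl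

namespace PathSpace

theorem source_edge_succ (x : PathSpace F) (n : ℕ) :
    (x.edge (n + 1)).source = (x.edge n).range := x.2.2 n

theorem vertex_succ (x : PathSpace F) (n : ℕ) : x.vertex (n + 1) = (x.edge n).range := x.2.2 n

@[ext]
theorem ext {x y : PathSpace F} (h : ∀ n, x.edge n = y.edge n) : x = y := by
  have h2 : x.1.2 = y.1.2 := funext h
  refine Subtype.ext (Prod.ext ?_ h2)
  rw [← x.2.1, ← y.2.1, h2]

/-- The path with a given sequence of edges. -/
def ofEdges (f : ℕ → Edge F) (h : ∀ n, (f (n + 1)).source = (f n).range) : PathSpace F :=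
  ⟨((f 0).source, f), rfl, h⟩

/-- The path that follows `y` up to level `n + 1` and `z` from there on. -/
def splice (y z : PathSpace F) (n : ℕ) (h : y.vertex n = z.vertex n) : PathSpace F :=
  ofEdges (fun k => if k < n then y.edge k else z.edge k) fun k => by
    rcases lt_trichotomy (k + 1) n with hk | hk | hk
    · simp only [hk, show k < n by omega, if_true]
      exact y.source_edge_succ k
    · subst hk
      simp only [lt_irrefl, if_false, Nat.lt_succ_self, if_true]
      rw [← vertex_succ, h]
      rfl
    · simp only [show ¬ k + 1 < n by omega, show ¬ k < n by omega, if_false]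
      exact z.source_edge_succ k

@[simp]
theorem edge_splice (y z : PathSpace F) (n : ℕ) (h : y.vertex n = z.vertex n) (k : ℕ) :
    (splice y z n h).edge k = if k < n then y.edge k else z.edge k := rfl

/-- The path that runs through a vertex with a loop forever. -/
def loop (hF : ∀ v, 0 < F v v) (i : Fin K) : PathSpace F :=
  ofEdges (fun _ => loopEdge hF i) fun _ => rfl

@[simp]
theorem vertex_loop (hF : ∀ v, 0 < F v v) (i : Fin K) (n : ℕ) : (loop hF i).vertex n = i := rfl

/-- The path that follows `x` up to level `n + 1`, then the edge `e`, then a loop. -/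
def extend (hF : ∀ v, 0 < F v v) (x : PathSpace F) (n : ℕ) (e : Edge F)
    (h : e.source = x.vertex n) : PathSpace F :=
  ofEdges (fun k => if k < n then x.edge k else if k = n then e
      else loopEdge hF e.range) fun k => by
    rcases lt_trichotomy (k + 1) n with hk | hk | hk
    · simp only [hk, show k < n by omega, if_true]
      exact x.source_edge_succ k
    · subst hk
      simp only [lt_irrefl, if_false, Nat.lt_succ_self, if_true]
      rw [h, vertex_succ]
    · simp only [show ¬ k + 1 < n by omega, show ¬ k < n by omega, show ¬ k + 1 = n by omega,
        if_false]
      split_ifs <;> simp_all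

@[simp]
theorem edge_extend (hF : ∀ v, 0 < F v v) (x : PathSpace F) (n : ℕ) (e : Edge F)
    (h : e.source = x.vertex n) (k : ℕ) : (extend hF x n e h).edge k =
      if k < n then x.edge k else if k = n then e
        else loopEdge hF e.range := rfl

theorem vertex_extend (hF : ∀ v, 0 < F v v) (x : PathSpace F) (n : ℕ) (e : Edge F)
    (h : e.source = x.vertex n) : (extend hF x n e h).vertex (n + 1) = e.range := by
  simp [vertex_succ]

theorem mem_cylinder_self (x : PathSpace F) (n : ℕ) : x ∈ x.cylinder n := ⟨rfl, fun _ _ => rfl⟩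

theorem cylinder_eq_of_mem {x y : PathSpace F} {n : ℕ} (h : y ∈ x.cylinder n) :
    y.cylinder n = x.cylinder n := by
  ext z
  simp only [cylinder, Set.mem_ofPred_eq, h.1]
  exact and_congr_right fun _ => forall₂_congr fun k hk => by rw [h.2 k hk]

theorem cylinder_anti (x : PathSpace F) {m n : ℕ} (h : m ≤ n) : x.cylinder n ⊆ x.cylinder m :=
  fun _ hy => ⟨hy.1, fun k hk => hy.2 k (hk.trans_le h)⟩

theorem vertex_eq_of_mem {x y : PathSpace F} {n : ℕ} (h : y ∈ x.cylinder n) :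
    y.vertex n = x.vertex n := by
  cases n with
  | zero => exact h.1
  | succ n => rw [vertex_succ, vertex_succ, h.2 n (Nat.lt_succ_self n)]

/-- At `n = 0` the edge condition is empty and `hn` is the whole content; for `n > 0` the initial
vertex is the source of the first edge. -/
theorem vertex_zero_congr {x y : PathSpace F} {n : ℕ} (h : ∀ k < n, x.edge k = y.edge k)
    (hn : x.vertex n = y.vertex n) : x.vertex 0 = y.vertex 0 := by
  cases n with
  | zero => exact hn
  | succ n => simp only [vertex, h 0 n.succ_pos]

theorem mem_cylinder_of_edge {x y : PathSpace F} {n : ℕ} (h : ∀ k < n, y.edge k = x.edge k)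
    (hn : y.vertex n = x.vertex n) : y ∈ x.cylinder n :=
  ⟨vertex_zero_congr h hn, h⟩

theorem disjoint_cylinder {x y : PathSpace F} {n : ℕ} (h : x.cylinder n ≠ y.cylinder n) :
    Disjoint (x.cylinder n) (y.cylinder n) := by
  rw [Set.disjoint_left]
  intro z hz hz'
  exact h ((cylinder_eq_of_mem hz).symm.trans (cylinder_eq_of_mem hz'))

theorem cylinder_inter_edge (hF : ∀ v, 0 < F v v) (x : PathSpace F) (n : ℕ) (e : Edge F)
    (h : e.source = x.vertex n) :
    {y | y.edge n = e} ∩ x.cylinder n = (extend hF x n e h).cylinder (n + 1) := by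
  have h0 : (extend hF x n e h).vertex 0 = x.vertex 0 := by
    refine vertex_zero_congr (n := n) (fun k hk => by simp [hk]) ?_
    simp only [vertex, edge_extend, lt_irrefl, if_false, if_true]
    exact h
  ext y
  simp only [cylinder, Set.mem_inter_iff, Set.mem_ofPred_eq, h0]
  constructor
  · rintro ⟨h1, h2, h3⟩
    refine ⟨h2, fun k hk => ?_⟩
    rcases Nat.lt_succ_iff_lt_or_eq.1 hk with hk | rfl
    · simp [hk, h3 k hk]
    · simp [h1]
  · rintro ⟨h2, h3⟩
    refine ⟨by simpa using h3 n n.lt_succ_self, h2, fun k hk => ?_⟩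
    simpa [hk] using h3 k (hk.trans n.lt_succ_self)

/-! ### Topology -/

theorem continuous_edge (n : ℕ) : Continuous fun x : PathSpace F => x.edge n :=
  (continuous_apply n).comp continuous_induced_dom

theorem continuous_vertex (n : ℕ) : Continuous fun x : PathSpace F => x.vertex n :=
  (continuous_of_discreteTopology (f := Edge.source)).comp (continuous_edge n)

theorem continuous_iff {X : Type*} [TopologicalSpace X] {f : X → PathSpace F} :
    Continuous f ↔ ∀ n, Continuous fun x => (f x).edge n :=
  continuous_induced_rng.trans continuous_pi_iff

theorem isClopen_edge (n : ℕ) (e : Edge F) : IsClopen {x : PathSpace F | x.edge n = e} :=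
  (isClopen_discrete {e}).preimage (continuous_edge n)

theorem isClopen_cylinder (x : PathSpace F) (n : ℕ) : IsClopen (x.cylinder n) := by
  have h : x.cylinder n = {y | y.vertex 0 = x.vertex 0} ∩
      ⋂ k ∈ Finset.range n, {y | y.edge k = x.edge k} := by
    ext y; simp [cylinder]
  rw [h]
  exact ((isClopen_discrete {x.vertex 0}).preimage (continuous_vertex 0)).inter
    (isClopen_biInter_finset fun k _ => isClopen_edge k _)

theorem measurableSet_cylinder (x : PathSpace F) (n : ℕ) : MeasurableSet (x.cylinder n) :=
  (isClopen_cylinder x n).isOpen.measurableSet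

theorem exists_cylinder_subset {U : Set (PathSpace F)} (hU : IsOpen U) {x : PathSpace F}
    (hx : x ∈ U) (N : ℕ) : ∃ n ≥ N, x.cylinder n ⊆ U := by
  obtain ⟨V, hV, rfl⟩ := isOpen_induced_iff.1 hU
  obtain ⟨I, u, hu, hI⟩ := isOpen_pi_iff.1 hV x.1.2 hx
  refine ⟨max N (I.sup id + 1), le_max_left _ _, fun y hy => hI fun k hk => ?_⟩
  have hk' : k ≤ I.sup id := Finset.le_sup (f := id) hk
  have h : y.1.2 k = x.1.2 k := hy.2 k (by omega)
  change y.1.2 k ∈ u k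
  exact h ▸ (hu k hk).2

/-- The cylinder sets of finite paths of length more than `N`. -/
def cylinders (F : Matrix (Fin K) (Fin K) ℕ) (N : ℕ) : Set (Set (PathSpace F)) :=
  {U | ∃ n ≥ N, ∃ x : PathSpace F, U = x.cylinder n}

theorem isTopologicalBasis_cylinders (N : ℕ) :
    TopologicalSpace.IsTopologicalBasis (cylinders F N) := by
  refine TopologicalSpace.isTopologicalBasis_of_isOpen_of_nhds ?_ ?_
  · rintro _ ⟨n, -, x, rfl⟩
    exact (isClopen_cylinder x n).isOpen
  · intro x U hx hU
    obtain ⟨n, hn, h⟩ := exists_cylinder_subset hU hx N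
    exact ⟨_, ⟨n, hn, x, rfl⟩, mem_cylinder_self x n, h⟩

theorem finite_range_cylinder (n : ℕ) :
    (Set.range fun x : PathSpace F => x.cylinder n).Finite := by
  refine (Set.finite_range fun p : Fin K × (Fin n → Edge F) =>
    {y : PathSpace F | y.vertex 0 = p.1 ∧ ∀ k : Fin n, y.edge k = p.2 k}).subset ?_
  rintro _ ⟨x, rfl⟩
  refine ⟨(x.vertex 0, fun k => x.edge k), ?_⟩
  ext y
  simp [cylinder, Fin.forall_iff]

theorem countable_cylinders (N : ℕ) : (cylinders F N).Countable := by
  refine (Set.countable_iUnion fun n => (finite_range_cylinder (F := F) n).countable).mono ?_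
  rintro _ ⟨n, -, x, rfl⟩
  exact Set.mem_iUnion.2 ⟨n, x, rfl⟩

theorem isPiSystem_cylinders (N : ℕ) : IsPiSystem (cylinders F N) := by
  rintro _ ⟨m, hm, x, rfl⟩ _ ⟨n, hn, y, rfl⟩ ⟨z, hz, hz'⟩
  refine ⟨max m n, hm.trans (le_max_left _ _), z, ?_⟩
  rw [← cylinder_eq_of_mem hz, ← cylinder_eq_of_mem hz']
  ext w
  simp only [cylinder, Set.mem_inter_iff, Set.mem_ofPred_eq, lt_max_iff]
  grind

instance : SecondCountableTopology (PathSpace F) :=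
  (isTopologicalBasis_cylinders 0).secondCountableTopology (countable_cylinders 0)

theorem isEmbedding_edges :
    Topology.IsEmbedding fun (x : PathSpace F) (n : ℕ) => x.edge n :=
  ⟨⟨rfl⟩, fun _ _ h => ext (congrFun h)⟩

instance : T2Space (PathSpace F) := isEmbedding_edges.t2Space

instance : TotallyDisconnectedSpace (PathSpace F) :=
  ⟨isEmbedding_edges.isTotallyDisconnected (isTotallyDisconnected_of_totallyDisconnectedSpace _)⟩

instance : CompactSpace (PathSpace F) := by
  have h : Topology.IsClosedEmbedding fun (x : PathSpace F) (n : ℕ) => x.edge n := by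
    refine ⟨isEmbedding_edges, ?_⟩
    have h : (Set.range fun (x : PathSpace F) (n : ℕ) => x.edge n) =
        ⋂ n, {f | (f (n + 1)).source = (f n).range} := by
      ext f
      simp only [Set.mem_range, Set.mem_iInter, Set.mem_ofPred_eq]
      exact ⟨fun ⟨x, hx⟩ n => hx ▸ x.source_edge_succ n, fun hf => ⟨ofEdges f hf, rfl⟩⟩
    rw [h]
    refine isClosed_iInter fun n => isClosed_eq ?_ ?_
    · exact (continuous_of_discreteTopology (f := Edge.source)).comp (continuous_apply _)
    · exact (continuous_of_discreteTopology (f := Edge.range)).comp (continuous_apply _)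
  exact h.compactSpace

/-- A clopen set contains with each point the cylinder set of some fixed length. -/
theorem exists_forall_cylinder_subset {U : Set (PathSpace F)} (hU : IsClopen U) :
    ∃ n, ∀ x ∈ U, x.cylinder n ⊆ U := by
  choose! m hm using fun (x : PathSpace F) (hx : x ∈ U) => exists_cylinder_subset hU.isOpen hx 0
  obtain ⟨t, ht, hUt⟩ := hU.isClosed.isCompact.elim_nhds_subcover (fun x => x.cylinder (m x))
    fun x _ => (isClopen_cylinder x _).isOpen.mem_nhds (mem_cylinder_self x _)
  refine ⟨t.sup m, fun y hy => ?_⟩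
  obtain ⟨x, hx, hyx⟩ := Set.mem_iUnion₂.1 (hUt hy)
  refine (cylinder_anti y (Finset.le_sup hx)).trans ?_
  rw [cylinder_eq_of_mem hyx]
  exact (hm x (ht x hx)).2

/-- The measure of a clopen set lies in every additive submonoid that contains the measures of the
cylinder sets. -/
theorem measureReal_mem_of_isClopen {μ : Measure (PathSpace F)} [IsFiniteMeasure μ]
    (G : AddSubmonoid ℝ) (hG : ∀ (x : PathSpace F) (n : ℕ), μ.real (x.cylinder n) ∈ G)
    {U : Set (PathSpace F)} (hU : IsClopen U) : μ.real U ∈ G := by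
  obtain ⟨n, hn⟩ := exists_forall_cylinder_subset hU
  have hfin : ((fun x : PathSpace F => x.cylinder n) '' U).Finite :=
    (finite_range_cylinder n).subset (Set.image_subset_range _ _)
  have hUeq : U = ⋃ V ∈ hfin.toFinset, id V := by
    ext x
    simp only [Set.Finite.mem_toFinset, Set.mem_iUnion, Set.mem_image, exists_prop, id]
    exact ⟨fun hx => ⟨_, ⟨x, hx, rfl⟩, mem_cylinder_self x n⟩,
      fun ⟨V, ⟨y, hy, hV⟩, hx⟩ => hn y hy (hV ▸ hx)⟩
  rw [hUeq, measureReal_biUnion_finset]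
  · refine sum_mem fun V hV => ?_
    obtain ⟨x, -, rfl⟩ := hfin.mem_toFinset.1 hV
    exact hG x n
  · intro V hV W hW hVW
    obtain ⟨x, -, rfl⟩ := hfin.mem_toFinset.1 hV
    obtain ⟨y, -, rfl⟩ := hfin.mem_toFinset.1 hW
    exact disjoint_cylinder hVW
  · intro V hV
    obtain ⟨x, -, rfl⟩ := hfin.mem_toFinset.1 hV
    exact measurableSet_cylinder x n

/-- Measures are determined by their values on long cylinder sets. -/
theorem measure_ext {μ ν : Measure (PathSpace F)} [IsFiniteMeasure μ] (N : ℕ)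
    (h : ∀ n ≥ N, ∀ x : PathSpace F, μ (x.cylinder n) = ν (x.cylinder n)) : μ = ν := by
  refine Measure.ext_of_generateFrom_of_cover_subset (S := cylinders F N) (T := cylinders F N)
    ?_ (isPiSystem_cylinders N) subset_rfl (countable_cylinders N)
    (isTopologicalBasis_cylinders N).sUnion_eq (fun _ _ => measure_ne_top _ _) ?_
  · rw [← (isTopologicalBasis_cylinders N).borel_eq_generateFrom]
    exact BorelSpace.measurable_eq
  · rintro _ ⟨n, hn, x, rfl⟩
    exact h n hn x

end PathSpace

end Bratteli

/-! ### Invariant measures and a criterion for ergodicity -/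

namespace Bratteli

open PathSpace

variable {K : ℕ} {F : Matrix (Fin K) (Fin K) ℕ}

namespace PathSpace

/-- Replace the initial segment up to level `n + 1` of a path by that of `y`, where possible. -/
def replace (y : PathSpace F) (n : ℕ) (z : PathSpace F) : PathSpace F :=
  if h : y.vertex n = z.vertex n then splice y z n h else z

theorem edge_replace (y : PathSpace F) (n : ℕ) (z : PathSpace F) (k : ℕ) :
    (replace y n z).edge k = if y.vertex n = (z.edge n).source ∧ k < n then y.edge k
      else z.edge k := by
  unfold replace
  by_cases h : y.vertex n = z.vertex n
  · have h' : y.vertex n = (z.edge n).source := h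
    simp [h, ← h']
  · have h' : ¬ y.vertex n = (z.edge n).source := h
    simp [h, h']

theorem continuous_replace (y : PathSpace F) (n : ℕ) : Continuous (replace y n) := by
  refine PathSpace.continuous_iff.2 fun k => ?_
  simp only [edge_replace]
  exact (continuous_of_discreteTopology (f := fun p : Edge F × Edge F =>
    if y.vertex n = p.1.source ∧ k < n then y.edge k else p.2)).comp
      ((continuous_edge n).prodMk (continuous_edge k))

theorem tailEquiv_replace (y : PathSpace F) (n : ℕ) (z : PathSpace F) :
    (replace y n z).TailEquiv z :=
  ⟨n, fun k hk => by simp [edge_replace, hk.not_gt]⟩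

end PathSpace

/-- An invariant measure gives equal mass to the parts of a saturated set in two cylinder sets
given by finite paths with the same end vertex. -/
theorem IsTailInvariant.measure_inter_cylinder {μ : Measure (PathSpace F)} [IsFiniteMeasure μ]
    (hμ : IsTailInvariant μ) {A : Set (PathSpace F)} (hA : MeasurableSet A)
    (hsat : ∀ x y : PathSpace F, x.TailEquiv y → (x ∈ A ↔ y ∈ A))
    {x y : PathSpace F} {n : ℕ} (hxy : x.vertex n = y.vertex n) :
    μ (A ∩ x.cylinder n) = μ (A ∩ y.cylinder n) := by
  have hg := (continuous_replace y n).measurable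
  have hmem : ∀ w ∈ x.cylinder n, replace y n w ∈ y.cylinder n := by
    intro w hw
    have hwy : y.vertex n = (w.edge n).source := (hxy.symm.trans (vertex_eq_of_mem hw).symm)
    refine mem_cylinder_of_edge (fun k hk => ?_) ?_
    · simp [edge_replace, hwy, hk]
    · simp only [vertex, edge_replace, lt_irrefl, and_false, if_false]
      exact hwy.symm
  -- Swapping the initial segment transports `μ` from one cylinder set to the other. On cylinder
  -- sets of length at least `n` this is precisely invariance.
  have key : (μ.restrict (x.cylinder n)).map (replace y n) = μ.restrict (y.cylinder n) := by
    refine measure_ext n fun m hm z => ?_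
    have hz := measurableSet_cylinder z m
    rw [Measure.map_apply hg hz, Measure.restrict_apply (hg hz), Measure.restrict_apply hz]
    by_cases hzy : z ∈ y.cylinder n
    · have hzx : x.vertex n = z.vertex n := hxy.trans (vertex_eq_of_mem hzy).symm
      have h1 : replace y n ⁻¹' z.cylinder m ∩ x.cylinder n = (splice x z n hzx).cylinder m := by
        ext w
        constructor
        · rintro ⟨hw, hwx⟩
          have hwy : y.vertex n = (w.edge n).source := hxy.symm.trans (vertex_eq_of_mem hwx).symm
          refine mem_cylinder_of_edge (fun k hk => ?_) ?_
          · have h := hw.2 k hk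
            rw [edge_replace] at h
            rw [edge_splice]
            split_ifs with hkn
            · exact hwx.2 k hkn
            · simpa [hkn] using h
          · have h := vertex_eq_of_mem hw
            simp only [vertex, edge_replace, hm.not_gt, and_false, if_false, edge_splice] at h ⊢
            exact h
        · intro hw
          have hwx : w ∈ x.cylinder n := by
            refine mem_cylinder_of_edge (fun k hk => ?_) ?_
            · simpa [hk] using hw.2 k (lt_of_lt_of_le hk hm)
            · rw [vertex_eq_of_mem (cylinder_anti _ hm hw), hzx]
              simp only [vertex, edge_splice, lt_irrefl, if_false]
          refine ⟨mem_cylinder_of_edge (fun k hk => ?_) ?_, hwx⟩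
          · by_cases hkn : k < n
            · rw [(hmem w hwx).2 k hkn, hzy.2 k hkn]
            · simpa [edge_replace, hkn] using hw.2 k hk
          · have h := vertex_eq_of_mem hw
            simp only [vertex, edge_replace, hm.not_gt, and_false, if_false, edge_splice] at h ⊢
            exact h
      have h2 : z.cylinder m ∩ y.cylinder n = z.cylinder m := by
        rw [← cylinder_eq_of_mem hzy]
        exact Set.inter_eq_left.2 (cylinder_anti z hm)
      rw [h1, h2]
      refine hμ _ _ _ ?_
      simp [vertex, hm.not_gt]
    · have hd : Disjoint (z.cylinder m) (y.cylinder n) := by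
        refine Set.disjoint_left.2 fun w hw hw' => hzy ?_
        rw [← cylinder_eq_of_mem hw', cylinder_eq_of_mem (cylinder_anti z hm hw)]
        exact mem_cylinder_self z n
      have h1 : replace y n ⁻¹' z.cylinder m ∩ x.cylinder n = ∅ :=
        Set.eq_empty_of_forall_notMem fun w hw => Set.disjoint_left.1 hd hw.1 (hmem w hw.2)
      rw [h1, hd.inter_eq]
  have h := congrArg (fun ν : Measure (PathSpace F) => ν A) key
  simp only [Measure.map_apply hg hA, Measure.restrict_apply (hg hA),
    Measure.restrict_apply hA] at h
  rw [← h]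
  -- Replacing an initial segment preserves the tail class, so the preimage of the saturated set `A`
  -- is `A` itself.
  congr 2
  ext w
  exact (hsat _ _ (tailEquiv_replace y n w)).symm

/-- The vector of the measures of the cylinder sets of finite paths with `n + 1` edges. -/
noncomputable def cylinderMeasure (hF : ∀ v, 0 < F v v) (ν : Measure (PathSpace F)) (n : ℕ)
    (i : Fin K) : ℝ := ν.real ((loop hF i).cylinder n)

theorem IsTailInvariant.measureReal_cylinder (hF : ∀ v, 0 < F v v) {ν : Measure (PathSpace F)}
    (hν : IsTailInvariant ν) (x : PathSpace F) (n : ℕ) :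
    ν.real (x.cylinder n) = cylinderMeasure hF ν n (x.vertex n) := by
  unfold cylinderMeasure Measure.real
  rw [hν x (loop hF (x.vertex n)) n rfl]

theorem measure_cylinder_eq_sum (ν : Measure (PathSpace F)) (x : PathSpace F) (n : ℕ) :
    ν (x.cylinder n) = ∑ e : Edge F, ν ({y | y.edge n = e} ∩ x.cylinder n) := by
  have h := sum_measure_preimage_singleton (μ := ν.restrict (x.cylinder n)) Finset.univ
    (f := fun y : PathSpace F => y.edge n) fun e _ => (isClopen_edge n e).isOpen.measurableSet
  simp only [Finset.coe_univ, Set.preimage_univ, Measure.restrict_apply_univ] at h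
  rw [← h]
  exact Finset.sum_congr rfl fun e _ =>
    Measure.restrict_apply (isClopen_edge n e).isOpen.measurableSet

/-- Split the cylinder set by the next edge and group the edges leaving `i` by their range. -/
theorem IsTailInvariant.cylinderMeasure_eq (hF : ∀ v, 0 < F v v) {ν : Measure (PathSpace F)}
    [IsFiniteMeasure ν] (hν : IsTailInvariant ν) (n : ℕ) (i : Fin K) :
    cylinderMeasure hF ν n i = ∑ v, (F v i : ℝ) * cylinderMeasure hF ν (n + 1) v := by
  rw [← sum_edge_source]
  unfold cylinderMeasure
  rw [Measure.real, measure_cylinder_eq_sum, ENNReal.toReal_sum fun e _ => measure_ne_top _ _]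
  refine Finset.sum_congr rfl fun e _ => ?_
  split_ifs with he
  · have he' : e.source = (loop hF i).vertex n := he
    rw [cylinder_inter_edge hF _ _ _ he']
    refine (hν.measureReal_cylinder hF _ _).trans ?_
    rw [vertex_extend]
    rfl
  · have : {y | y.edge n = e} ∩ (loop hF i).cylinder n = ∅ := by
      refine Set.eq_empty_of_forall_notMem fun y hy => he ?_
      have h := vertex_eq_of_mem hy.2
      rw [vertex_loop] at h
      rw [← h, ← hy.1]
      rfl
    simp [this]

/-- An invariant probability measure is ergodic if, for every invariant measure below it, the
vectors of the measures of the cylinder sets are proportional. -/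
theorem isErgodicInvariant_of_proportional (hF : ∀ v, 0 < F v v) {μ : Measure (PathSpace F)}
    [IsProbabilityMeasure μ] (hμ : IsTailInvariant μ)
    (h : ∀ a : ℕ → Fin K → ℝ, (∀ n i, 0 ≤ a n i) → (∀ n i, a n i ≤ cylinderMeasure hF μ n i) →
      (∀ n i, a n i = ∑ v, (F v i : ℝ) * a (n + 1) v) →
      ∃ c : ℝ, ∀ n i, a n i = c * cylinderMeasure hF μ n i) : IsErgodicInvariant μ := by
  refine ⟨inferInstance, hμ, fun A hA hsat => ?_⟩
  have hν : IsTailInvariant (μ.restrict A) := by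
    intro x y n hxy
    rw [Measure.restrict_apply (measurableSet_cylinder _ _),
      Measure.restrict_apply (measurableSet_cylinder _ _), Set.inter_comm, Set.inter_comm _ A]
    exact hμ.measure_inter_cylinder hA hsat hxy
  obtain ⟨c, hc⟩ := h (cylinderMeasure hF (μ.restrict A)) (fun n i => measureReal_nonneg)
    (fun n i => ENNReal.toReal_mono (measure_ne_top _ _) (Measure.restrict_le_self _))
    (fun n i => hν.cylinderMeasure_eq hF n i)
  -- A negative `c` would force all cylinder values of `μ` to vanish, since both vectors are
  -- nonnegative.
  have hc0 : 0 ≤ c := by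
    by_contra hneg
    have h0 : ∀ n i, cylinderMeasure hF μ n i = 0 := fun n i => by
      have h1 : 0 ≤ cylinderMeasure hF (μ.restrict A) n i := measureReal_nonneg
      have h2 : 0 ≤ cylinderMeasure hF μ n i := measureReal_nonneg
      rw [hc] at h1
      nlinarith
    have : μ = 0 := measure_ext 0 fun n _ x => by
      have := hμ.measureReal_cylinder hF x n
      rw [h0, measureReal_eq_zero_iff] at this
      simp [this]
    exact IsProbabilityMeasure.ne_zero μ this
  have hνμ : μ.restrict A = ENNReal.ofReal c • μ := by
    refine measure_ext 0 fun n _ x => ?_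
    rw [← ofReal_measureReal (μ := μ.restrict A), hν.measureReal_cylinder hF, hc,
      ENNReal.ofReal_mul hc0, ← hμ.measureReal_cylinder hF, ofReal_measureReal]
    rfl
  -- Evaluate `μ.restrict A = c μ` at `A` if `c = 0`, and at `Aᶜ` if `c > 0`.
  rcases hc0.eq_or_lt with rfl | hcpos
  · left
    have := congrArg (fun ν : Measure (PathSpace F) => ν A) hνμ
    simpa using this
  · right
    have h1 := congrArg (fun ν : Measure (PathSpace F) => ν Aᶜ) hνμ
    simp only [Measure.restrict_apply hA.compl, Set.compl_inter_self, measure_empty,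
      Measure.smul_apply, smul_eq_mul] at h1
    rcases mul_eq_zero.1 h1.symm with h2 | h2
    · exact absurd (ENNReal.ofReal_eq_zero.1 h2) hcpos.not_ge
    · exact h2

end Bratteli

/-! ### The Markov measure of an eigenvector -/

namespace Bratteli

open PathSpace

variable {K : ℕ} {F : Matrix (Fin K) (Fin K) ℕ}

/-- The edges with source `w`. -/
abbrev OutEdge (F : Matrix (Fin K) (Fin K) ℕ) (w : Fin K) : Type := {e : Edge F // e.source = w}

instance (w : Fin K) : MeasurableSpace (OutEdge F w) := ⊤

instance (w : Fin K) : DiscreteMeasurableSpace (OutEdge F w) := ⟨fun _ => trivial⟩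

/-- The vertices visited by the path that starts at `v` and leaves the vertex `w` of level `n + 1`
along the edge `s (n, w)`. -/
def followVertex (v : Fin K) (s : (p : ℕ × Fin K) → OutEdge F p.2) : ℕ → Fin K
  | 0 => v
  | n + 1 => (s (n, followVertex v s n)).1.range

/-- The path that starts at `v` and leaves the vertex `w` of level `n + 1` along the edge
`s (n, w)`. -/
def follow (q : Fin K × ((p : ℕ × Fin K) → OutEdge F p.2)) : PathSpace F :=
  ofEdges (fun n => (q.2 (n, followVertex q.1 q.2 n)).1) fun n =>
    (q.2 (n + 1, followVertex q.1 q.2 (n + 1))).2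

theorem vertex_follow (q : Fin K × ((p : ℕ × Fin K) → OutEdge F p.2)) (n : ℕ) :
    (follow q).vertex n = followVertex q.1 q.2 n :=
  (q.2 (n, followVertex q.1 q.2 n)).2

/-- As long as the followed path agrees with `x` it stands at `x.vertex k`, so only the choices made
at the vertices of `x` are consulted. -/
theorem follow_mem_cylinder (q : Fin K × ((p : ℕ × Fin K) → OutEdge F p.2)) (x : PathSpace F)
    (n : ℕ) : follow q ∈ x.cylinder n ↔
      q.1 = x.vertex 0 ∧ ∀ k < n, (q.2 (k, x.vertex k)).1 = x.edge k := by
  induction n with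
  | zero => simp [PathSpace.cylinder, vertex_follow, followVertex]
  | succ n ih =>
    have h : follow q ∈ x.cylinder (n + 1) ↔
        follow q ∈ x.cylinder n ∧ (follow q).edge n = x.edge n := by
      simp only [PathSpace.cylinder, Set.mem_ofPred_eq, Nat.forall_lt_succ_right, and_assoc]
    rw [h, Nat.forall_lt_succ_right, ← and_assoc, ← ih]
    refine and_congr_right fun hn => ?_
    have hv := vertex_eq_of_mem hn
    rw [vertex_follow] at hv
    change (q.2 (n, followVertex q.1 q.2 n)).1 = x.edge n ↔ _
    rw [hv]

/-- The cylinder set of `x` as a condition on the choices of edges. -/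
theorem preimage_follow_cylinder (x : PathSpace F) (n : ℕ) :
    follow ⁻¹' x.cylinder n = {x.vertex 0} ×ˢ
      Set.pi ((Finset.range n).image fun k => (k, x.vertex k) : Finset (ℕ × Fin K))
        (fun p : ℕ × Fin K => {e : OutEdge F p.2 | e.1 = x.edge p.1}) := by
  ext q
  rw [Set.mem_preimage, follow_mem_cylinder]
  simp [Set.mem_pi]

theorem measurable_follow : Measurable (follow (F := F)) := by
  have h : (inferInstance : MeasurableSpace (PathSpace F)) =
      MeasurableSpace.generateFrom (cylinders F 0) := by
    rw [← (isTopologicalBasis_cylinders 0).borel_eq_generateFrom]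
    exact BorelSpace.measurable_eq
  have h' : @Measurable _ _ _ (MeasurableSpace.generateFrom (cylinders F 0)) (follow (F := F)) := by
    refine measurable_generateFrom ?_
    rintro _ ⟨n, -, x, rfl⟩
    rw [preimage_follow_cylinder]
    exact (MeasurableSet.singleton _).prod
      (MeasurableSet.pi (Finset.countable_toSet _) fun _ _ => MeasurableSet.of_discrete)
  exact h'.mono le_rfl h.le

/-- The transition probabilities of the Markov chain given by an eigenvector. -/
theorem exists_transition (hF : ∀ v, 0 < F v v) {lam : ℝ} (hlam : 0 < lam) {ξ : Fin K → ℝ}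
    (hξ : ∀ i, 0 ≤ ξ i) (heig : ∀ w, ∑ v, (F v w : ℝ) * ξ v = lam * ξ w) (w : Fin K) :
    ∃ p : PMF (OutEdge F w), ∀ e : OutEdge F w,
      ENNReal.ofReal (ξ w) * p e = ENNReal.ofReal (ξ e.1.range / lam) := by
  rcases (hξ w).eq_or_lt with hw | hw
  -- If `ξ w = 0`, the eigenvector equation makes `ξ` vanish at the range of every edge leaving `w`,
  -- so any law works.
  · refine ⟨PMF.pure ⟨loopEdge hF w, rfl⟩, fun e => ?_⟩
    have h0 : ξ e.1.range = 0 := by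
      have h := heig w
      rw [← hw, mul_zero, Finset.sum_eq_zero_iff_of_nonneg
        fun v _ => mul_nonneg (Nat.cast_nonneg _) (hξ v)] at h
      refine (mul_eq_zero.1 (h e.1.range (Finset.mem_univ _))).resolve_left ?_
      obtain ⟨⟨v, w', i⟩, rfl⟩ := e
      exact Nat.cast_ne_zero.2 (Nat.zero_lt_of_lt i.2).ne'
    simp [← hw, h0]
  · have hsum : ∑ e : OutEdge F w, ENNReal.ofReal (ξ e.1.range / (lam * ξ w)) = 1 := by
      have h := Finset.sum_subtype (F := inferInstanceAs (Fintype (OutEdge F w)))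
        (Finset.univ.filter fun e : Edge F => e.source = w)
        (p := fun e => e.source = w) (by simp) (fun e => ξ e.range)
      rw [Finset.sum_filter, sum_edge_source, heig] at h
      rw [← ENNReal.ofReal_sum_of_nonneg fun e _ => div_nonneg (hξ _) (by positivity),
        ← Finset.sum_div, ← h, div_self (by positivity), ENNReal.ofReal_one]
    refine ⟨PMF.ofFintype _ hsum, fun e => ?_⟩
    rw [PMF.ofFintype_apply, ← ENNReal.ofReal_mul hw.le]
    congr 1
    field_simp

/-- A probability eigenvector defines a measure on the path space. -/
theorem exists_measure_of_eigenvector (hF : ∀ v, 0 < F v v) {lam : ℝ} (hlam : 0 < lam)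
    {ξ : Fin K → ℝ} (hξ : ∀ i, 0 ≤ ξ i) (hsum : ∑ i, ξ i = 1)
    (heig : ∀ w, ∑ v, (F v w : ℝ) * ξ v = lam * ξ w) :
    ∃ μ : Measure (PathSpace F), ∀ (x : PathSpace F) (n : ℕ),
      μ (x.cylinder n) = ENNReal.ofReal (ξ (x.vertex n) / lam ^ n) := by
  choose p hp using exists_transition hF hlam hξ heig
  have hsum' : ∑ i, ENNReal.ofReal (ξ i) = 1 := by
    rw [← ENNReal.ofReal_sum_of_nonneg fun i _ => hξ i, hsum, ENNReal.ofReal_one]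
  -- Outgoing edges are chosen independently at all vertices of all levels. The vertices of a path
  -- lie on distinct levels, so the probability of a cylinder set is a product, which telescopes.
  let P : Measure ((q : ℕ × Fin K) → OutEdge F q.2) :=
    Measure.infinitePi fun q => (p q.2).toMeasure
  refine ⟨((PMF.ofFintype _ hsum').toMeasure.prod P).map follow, fun x n => ?_⟩
  rw [Measure.map_apply measurable_follow (measurableSet_cylinder x n), preimage_follow_cylinder,
    Measure.prod_prod, PMF.toMeasure_apply_singleton _ _ (MeasurableSet.singleton _),
    Measure.infinitePi_pi _ fun _ _ => MeasurableSet.of_discrete,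
    Finset.prod_image fun a _ b _ h => congrArg Prod.fst h, PMF.ofFintype_apply]
  have hedge : ∀ k, (p (x.vertex k)).toMeasure {e : OutEdge F (x.vertex k) | e.1 = x.edge k} =
      p (x.vertex k) ⟨x.edge k, rfl⟩ := fun k => by
    rw [← PMF.toMeasure_apply_singleton _ _ (MeasurableSet.singleton _)]
    congr 1
    ext e
    simp [Subtype.ext_iff]
  simp only [hedge]
  induction n with
  | zero => simp
  | succ n ih =>
    rw [Finset.prod_range_succ, ← mul_assoc, ih, div_eq_mul_inv, ENNReal.ofReal_mul (hξ _),
      mul_right_comm, hp, ← ENNReal.ofReal_mul (div_nonneg (hξ _) hlam.le), vertex_succ, pow_succ]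
    congr 1
    field_simp

end Bratteli

/-! ### Clopen values of relative measures and of measures on the support -/

namespace CantorMeasure

theorem relative_real {X : Type*} [MeasurableSpace X] {μ : Measure X} {U : Set X} (hU : MeasurableSet U)
    (V : Set U) : (relative μ U).real V = μ.real (Subtype.val '' V) / μ.real U := by
  rw [relative, Measure.real, (MeasurableEmbedding.subtype_coe hU).comap_apply,
    ProbabilityTheory.cond_apply hU, ENNReal.toReal_mul, ENNReal.toReal_inv,
    Set.inter_eq_right.2 (Subtype.coe_image_subset U V), div_eq_inv_mul]
  rfl

/-- `U` is the trace of an open set `O`, and its image is closed in `X`; total disconnectedness and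
compactness give a clopen set between the image and `O`. -/
theorem exists_isClopen_preimage_val {X : Type*} [TopologicalSpace X] [CompactSpace X]
    [T2Space X] [TotallyDisconnectedSpace X] {Y : Set X} (hY : IsClosed Y) {U : Set Y}
    (hU : IsClopen U) :
    ∃ W : Set X, IsClopen W ∧ Subtype.val ⁻¹' W = U := by
  obtain ⟨O, hO, rfl⟩ := isOpen_induced_iff.1 hU.isOpen
  obtain ⟨W, hW, hUW, hWO⟩ := exists_clopen_of_closed_subset_open
    (hY.isClosedMap_subtype_val _ hU.isClosed) hO (Set.image_preimage_subset _ _)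
  exact ⟨W, hW, (Set.preimage_mono hWO).antisymm (Set.image_subset_iff.1 hUW)⟩

section ClopenValues

variable {X : Type*} [TopologicalSpace X] [MeasurableSpace X] [OpensMeasurableSpace X]

theorem mem_clopenValues_relative {μ : Measure X} {U : Set X} (hU : IsClopen U) {r : ℝ} :
    r ∈ clopenValues (relative μ U) ↔
      ∃ V : Set X, IsClopen V ∧ V ⊆ U ∧ r = μ.real V / μ.real U := by
  constructor
  · rintro ⟨V, hV, rfl⟩
    exact ⟨_, ⟨hU.isClosed.isClosedMap_subtype_val _ hV.isClosed,
      hU.isOpen.isOpenMap_subtype_val _ hV.isOpen⟩, Subtype.coe_image_subset U V,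
      relative_real hU.isOpen.measurableSet V⟩
  · rintro ⟨V, hV, hVU, rfl⟩
    refine ⟨Subtype.val ⁻¹' V, hV.preimage continuous_subtype_val, ?_⟩
    rw [relative_real hU.isOpen.measurableSet, Subtype.image_preimage_coe,
      Set.inter_eq_right.2 hVU]

/-- The clopen values set of a measure of Bernoulli type is closed under multiplication. -/
theorem IsBernoulliType.mul_mem {μ : Measure X} [IsFiniteMeasure μ] (h : IsBernoulliType μ)
    {r s : ℝ} (hr : r ∈ clopenValues μ) (hs : s ∈ clopenValues μ) : r * s ∈ clopenValues μ := by
  obtain ⟨𝓑, ⟨-, hcover⟩, htype⟩ := h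
  obtain ⟨W, hW, rfl⟩ := hs
  rcases W.eq_empty_or_nonempty with rfl | hne
  · exact ⟨∅, isClopen_empty, by simp⟩
  obtain ⟨P, hP𝓑, hPfin, hPdisj, hPW⟩ := hcover W hW hne
  -- Since `r` is also a relative value of each piece `U`, a clopen part of `U` has measure `r
  -- μ(U)`. The union of these parts has measure `r μ(W)`.
  have hex : ∀ U ∈ P, ∃ V : Set X, IsClopen V ∧ V ⊆ U ∧ μ.real V = r * μ.real U := by
    intro U hU
    obtain ⟨hUc, -, hUS⟩ := htype U (hP𝓑 hU)
    obtain ⟨V, hV, hVU, hrV⟩ := (mem_clopenValues_relative hUc).1 (hUS ▸ hr)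
    refine ⟨V, hV, hVU, ?_⟩
    rcases eq_or_ne (μ.real U) 0 with h0 | h0
    · rw [h0, mul_zero]
      exact le_antisymm (h0 ▸ measureReal_mono hVU) measureReal_nonneg
    · rw [hrV, div_mul_cancel₀ _ h0]
  choose! V hV hVU hμV using hex
  have hVdisj : (hPfin.toFinset : Set (Set X)).PairwiseDisjoint V := by
    intro A hA B hB hAB
    rw [Finset.mem_coe, Set.Finite.mem_toFinset] at hA hB
    exact (hPdisj hA hB hAB).mono (hVU A hA) (hVU B hB)
  refine ⟨⋃ U ∈ hPfin.toFinset, V U,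
    isClopen_biUnion_finset fun U hU => hV U (hPfin.mem_toFinset.1 hU), ?_⟩
  have hWeq : W = ⋃ U ∈ hPfin.toFinset, id U := by
    rw [← hPW, Set.sUnion_eq_biUnion]
    simp
  rw [measureReal_biUnion_finset hVdisj
      fun U hU => (hV U (hPfin.mem_toFinset.1 hU)).isOpen.measurableSet]
  conv_lhs => rw [hWeq]
  rw [measureReal_biUnion_finset (f := id) (by simpa using hPdisj) fun U hU =>
      (htype U (hP𝓑 (hPfin.mem_toFinset.1 hU))).1.isOpen.measurableSet, Finset.mul_sum]
  exact Finset.sum_congr rfl fun U hU => (hμV U (hPfin.mem_toFinset.1 hU)).symm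

end ClopenValues

section Support

variable {X : Type*} [TopologicalSpace X] [MeasurableSpace X] [OpensMeasurableSpace X]
  [SecondCountableTopology X]

/-- By second countability the complement of the support is null. -/
theorem onSupport_real_preimage (μ : Measure X) (W : Set X) :
    (onSupport μ).real (Subtype.val ⁻¹' W) = μ.real W := by
  rw [onSupport, Measure.real, (MeasurableEmbedding.subtype_coe
    Measure.isClosed_support.measurableSet).comap_apply, Subtype.image_preimage_coe,
    Set.inter_comm, measure_inter_conull' ]
  · rfl
  · exact measure_mono_null (Set.sdiff_subset_compl _ _) Measure.measure_compl_support

instance (μ : Measure X) [IsFiniteMeasure μ] : IsFiniteMeasure (onSupport μ) := by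
  unfold onSupport; infer_instance

variable [CompactSpace X] [T2Space X] [TotallyDisconnectedSpace X]

theorem clopenValues_onSupport (μ : Measure X) :
    clopenValues (onSupport μ) = clopenValues μ := by
  ext r
  constructor
  · rintro ⟨U, hU, rfl⟩
    obtain ⟨W, hW, rfl⟩ := exists_isClopen_preimage_val Measure.isClosed_support hU
    exact ⟨W, hW, onSupport_real_preimage μ W⟩
  · rintro ⟨W, hW, rfl⟩
    exact ⟨_, hW.preimage continuous_subtype_val, (onSupport_real_preimage μ W).symm⟩

theorem mem_clopenValues_relative_onSupport {μ : Measure X} {U : Set X} (hU : IsClopen U) {r : ℝ} :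
    r ∈ clopenValues (relative (onSupport μ) (Subtype.val ⁻¹' U)) ↔
      ∃ V : Set X, IsClopen V ∧ V ⊆ U ∧ r = μ.real V / μ.real U := by
  rw [mem_clopenValues_relative (hU.preimage continuous_subtype_val)]
  constructor
  · rintro ⟨V, hV, hVU, rfl⟩
    obtain ⟨W, hW, rfl⟩ := exists_isClopen_preimage_val Measure.isClosed_support hV
    -- The extension `W` need not lie in `U`, but `W ∩ U` has the same trace on the support.
    refine ⟨W ∩ U, hW.inter hU, Set.inter_subset_right, ?_⟩
    rw [← onSupport_real_preimage μ U, ← onSupport_real_preimage μ (W ∩ U), Set.preimage_inter,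
      Set.inter_eq_left.2 hVU]
  · rintro ⟨V, hV, hVU, rfl⟩
    exact ⟨_, hV.preimage continuous_subtype_val, Set.preimage_mono hVU, by
      rw [onSupport_real_preimage, onSupport_real_preimage]⟩

end Support

end CantorMeasure

/-! ### A sufficient condition for Bernoulli type -/

namespace Bratteli

open PathSpace CantorMeasure

/-- A measure on the path space is of Bernoulli type on its support if the cylinder sets of
positive measure are of `μ` type. -/
theorem isBernoulliType_onSupport {K : ℕ} {F : Matrix (Fin K) (Fin K) ℕ}
    (μ : Measure (PathSpace F))
    (h : ∀ (x : PathSpace F) (n : ℕ), μ (x.cylinder n) ≠ 0 → ∀ r : ℝ,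
      (∃ V, IsClopen V ∧ V ⊆ x.cylinder n ∧ r = μ.real V / μ.real (x.cylinder n)) ↔
        r ∈ clopenValues μ) : IsBernoulliType (onSupport μ) := by
  refine ⟨{U | ∃ (x : μ.support) (n : ℕ), U = Subtype.val ⁻¹' x.1.cylinder n}, ⟨?_, ?_⟩, ?_⟩
  · rintro _ ⟨x, n, rfl⟩
    exact (isClopen_cylinder _ n).preimage continuous_subtype_val
  · intro U hU _
    obtain ⟨W, hW, rfl⟩ := exists_isClopen_preimage_val Measure.isClosed_support hU
    obtain ⟨n, hn⟩ := exists_forall_cylinder_subset hW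
    refine ⟨(fun x : μ.support => Subtype.val ⁻¹' x.1.cylinder n) '' (Subtype.val ⁻¹' W),
      ?_, ?_, ?_, ?_⟩
    · rintro _ ⟨x, -, rfl⟩
      exact ⟨x, n, rfl⟩
    · refine ((finite_range_cylinder n).image fun V => (Subtype.val ⁻¹' V : Set μ.support)).subset ?_
      rintro _ ⟨x, -, rfl⟩
      exact ⟨_, ⟨x.1, rfl⟩, rfl⟩
    · rintro _ ⟨x, -, rfl⟩ _ ⟨y, -, rfl⟩ hxy
      exact (disjoint_cylinder fun h => hxy (by simp only [h])).preimage _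
    · ext x
      constructor
      · rintro ⟨_, ⟨y, hy, rfl⟩, hx⟩
        exact hn y.1 hy hx
      · exact fun hx => ⟨_, ⟨x, hx, rfl⟩, mem_cylinder_self x.1 n⟩
  · rintro _ ⟨x, n, rfl⟩
    have hc := isClopen_cylinder x.1 n
    refine ⟨hc.preimage continuous_subtype_val, ⟨x, mem_cylinder_self x.1 n⟩, ?_⟩
    ext r
    rw [mem_clopenValues_relative_onSupport hc, clopenValues_onSupport]
    -- A cylinder set through a point of the support has positive measure.
    refine h x.1 n (ne_of_gt ?_) r
    exact (Measure.mem_support_iff_forall x.1).1 x.2 _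
      (hc.isOpen.mem_nhds (mem_cylinder_self x.1 n))

end Bratteli

/-! ### Eigenmeasures, ergodicity, and failure of Bernoulli type for `3` -/

namespace Bratteli

open PathSpace CantorMeasure

section Eigenmeasure

variable {K : ℕ} {F : Matrix (Fin K) (Fin K) ℕ}

/-- The cylinder set of a finite path with `n + 1` edges that ends at the vertex `i` has
measure `ξ i / lam ^ n`. -/
def HasCylinderValues (lam : ℝ) (ξ : Fin K → ℝ) (μ : Measure (PathSpace F)) : Prop :=
  ∀ (x : PathSpace F) (n : ℕ), μ (x.cylinder n) = ENNReal.ofReal (ξ (x.vertex n) / lam ^ n)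

variable {lam : ℝ} {ξ : Fin K → ℝ} {μ : Measure (PathSpace F)}

theorem mulVec_transpose_eq_smul_iff : Matrix.mulVec (F.map (fun k : ℕ => (k : ℝ))).transpose ξ =
    lam • ξ ↔ ∀ w, ∑ v, (F v w : ℝ) * ξ v = lam * ξ w := by
  rw [funext_iff]
  rfl

theorem HasCylinderValues.isTailInvariant (h : HasCylinderValues lam ξ μ) : IsTailInvariant μ :=
  fun x y n hxy => by rw [h, h, hxy]

theorem HasCylinderValues.isProbabilityMeasure (hF : ∀ v, 0 < F v v) (hξ : ∀ i, 0 ≤ ξ i)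
    (hsum : ∑ i, ξ i = 1) (h : HasCylinderValues lam ξ μ) : IsProbabilityMeasure μ := by
  have h1 := sum_measure_preimage_singleton (μ := μ) Finset.univ
    (f := fun y : PathSpace F => y.vertex 0)
    fun e _ => ((isClopen_discrete {e}).preimage (continuous_vertex 0)).isOpen.measurableSet
  have h2 : ∀ i, (fun y : PathSpace F => y.vertex 0) ⁻¹' {i} = (loop hF i).cylinder 0 := by
    intro i
    ext y
    simp [PathSpace.cylinder]
  simp only [h2, h _ 0, vertex_loop, pow_zero, div_one, Finset.coe_univ, Set.preimage_univ] at h1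
  rw [← ENNReal.ofReal_sum_of_nonneg fun i _ => hξ i, hsum, ENNReal.ofReal_one] at h1
  exact ⟨h1.symm⟩

theorem HasCylinderValues.measureReal (hξ : ∀ i, 0 ≤ ξ i) (hlam : 0 < lam)
    (h : HasCylinderValues lam ξ μ) (x : PathSpace F) (n : ℕ) :
    μ.real (x.cylinder n) = ξ (x.vertex n) / lam ^ n := by
  rw [Measure.real, h, ENNReal.toReal_ofReal (div_nonneg (hξ _) (by positivity))]

/-- If a positive real is an eigenvalue with a unique probability eigenvector, then it defines
exactly one measure, and its cylinder values are given by the eigenvector. -/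
theorem existsUnique_isDefinedByEigenvalue (hF : ∀ v, 0 < F v v) (hlam : 0 < lam)
    (hξ : ∀ i, 0 ≤ ξ i) (hsum : ∑ i, ξ i = 1) (heig : ∀ w, ∑ v, (F v w : ℝ) * ξ v = lam * ξ w)
    (huniq : ∀ ζ : Fin K → ℝ, ∑ i, ζ i = 1 → (∀ w, ∑ v, (F v w : ℝ) * ζ v = lam * ζ w) → ζ = ξ) :
    (∃! ν : Measure (PathSpace F), IsDefinedByEigenvalue lam ν) ∧
      ∀ ν : Measure (PathSpace F), IsDefinedByEigenvalue lam ν → HasCylinderValues lam ξ ν := by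
  have hval : ∀ ν : Measure (PathSpace F), IsDefinedByEigenvalue lam ν →
      HasCylinderValues lam ξ ν := by
    rintro ν ⟨ζ, -, hζsum, hζ, hν⟩
    exact huniq ζ hζsum (mulVec_transpose_eq_smul_iff.1 hζ) ▸ hν
  obtain ⟨ν, hν⟩ := exists_measure_of_eigenvector hF hlam hξ hsum heig
  refine ⟨⟨ν, ⟨ξ, hξ, hsum, mulVec_transpose_eq_smul_iff.2 heig, hν⟩, fun ν' hν' => ?_⟩, hval⟩
  have : IsProbabilityMeasure ν' := (hval ν' hν').isProbabilityMeasure hF hξ hsum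
  exact measure_ext 0 fun n _ x => (hval ν' hν' x n).trans (hν x n).symm

/-- A solution of a linear recursion with ratio `θ⁻¹` that decays faster vanishes. -/
theorem eq_zero_of_decay {u : ℕ → ℝ} {θ C : ℝ} (hlam : 0 < lam) (hθ0 : 0 < θ) (hθ : θ < lam)
    (hu : ∀ n, u n = θ * u (n + 1)) (hC : ∀ n, |u n| ≤ C / lam ^ n) (n : ℕ) : u n = 0 := by
  -- Hence `|u 0| ≤ C (θ / lam) ^ n` for all `n`, which tends to zero.
  have h0 : ∀ n, u 0 = θ ^ n * u n := fun n => by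
    induction n with
    | zero => simp
    | succ n ih => rw [ih, hu n]; ring
  have hlim : Filter.Tendsto (fun n : ℕ => C * (θ / lam) ^ n) Filter.atTop (nhds 0) := by
    simpa using (tendsto_pow_atTop_nhds_zero_of_lt_one (by positivity)
      ((div_lt_one hlam).2 hθ)).const_mul C
  have hle : |u 0| ≤ 0 := ge_of_tendsto' hlim fun n => by
    rw [h0 n, abs_mul, abs_of_pos (pow_pos hθ0 n), div_pow]
    calc θ ^ n * |u n| ≤ θ ^ n * (C / lam ^ n) := by gcongr; exact hC n
      _ = C * (θ ^ n / lam ^ n) := by ring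
  have h1 := h0 n
  rw [abs_nonpos_iff.1 hle] at h1
  exact (mul_eq_zero.1 h1.symm).resolve_left (pow_pos hθ0 n).ne'

end Eigenmeasure

section Example

open Real

theorem exampleMatrix_diag (v : Fin 3) : 0 < exampleMatrix v v := by
  fin_cases v <;> simp [exampleMatrix]

theorem sum_exampleMatrix_mul (a : Fin 3 → ℝ) (w : Fin 3) :
    ∑ v, (exampleMatrix v w : ℝ) * a v = ![a 0 + a 1, a 0 + 2 * a 1 + a 2, 3 * a 2] w := by
  fin_cases w <;> simp [exampleMatrix, Fin.sum_univ_three]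

theorem eigenvector_iff {lam : ℝ} {ξ : Fin 3 → ℝ} :
    (∀ w, ∑ v, (exampleMatrix v w : ℝ) * ξ v = lam * ξ w) ↔
      ξ 0 + ξ 1 = lam * ξ 0 ∧ ξ 0 + 2 * ξ 1 + ξ 2 = lam * ξ 1 ∧ 3 * ξ 2 = lam * ξ 2 := by
  simp only [sum_exampleMatrix_mul, Fin.forall_fin_succ]
  simp

/-- The probability eigenvector for the eigenvalue `1 + φ = (3 + √5) / 2`. -/
noncomputable def goldenVector : Fin 3 → ℝ := ![2 - goldenRatio, goldenRatio - 1, 0]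

/-- The probability eigenvector for the eigenvalue `3`. -/
noncomputable def tripleVector : Fin 3 → ℝ := ![1 / 4, 1 / 2, 1 / 4]

theorem goldenVector_nonneg (i : Fin 3) : 0 ≤ goldenVector i := by
  have h1 := one_lt_goldenRatio
  have h2 := goldenRatio_lt_two
  fin_cases i <;> simp [goldenVector] <;> linarith

theorem tripleVector_nonneg (i : Fin 3) : 0 ≤ tripleVector i := by
  fin_cases i <;> norm_num [tripleVector]

theorem sum_goldenVector : ∑ i, goldenVector i = 1 := by
  simp only [goldenVector, Fin.sum_univ_three, Matrix.cons_val]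
  ring

theorem sum_tripleVector : ∑ i, tripleVector i = 1 := by
  simp only [tripleVector, Fin.sum_univ_three, Matrix.cons_val]
  norm_num

theorem goldenVector_eigenvector (w : Fin 3) :
    ∑ v, (exampleMatrix v w : ℝ) * goldenVector v = (1 + goldenRatio) * goldenVector w := by
  have h := goldenRatio_sq
  refine eigenvector_iff.2 ⟨?_, ?_, ?_⟩ w
  · simp [goldenVector]; linear_combination h
  · simp [goldenVector]; linear_combination -h
  · simp [goldenVector]

theorem tripleVector_eigenvector (w : Fin 3) :
    ∑ v, (exampleMatrix v w : ℝ) * tripleVector v = 3 * tripleVector w :=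
  eigenvector_iff.2 (by simp only [tripleVector, Matrix.cons_val]; norm_num) w

theorem eq_goldenVector {ζ : Fin 3 → ℝ} (hsum : ∑ i, ζ i = 1)
    (h : ∀ w, ∑ v, (exampleMatrix v w : ℝ) * ζ v = (1 + goldenRatio) * ζ w) :
    ζ = goldenVector := by
  have h1 := goldenRatio_lt_two
  have hsq := goldenRatio_sq
  obtain ⟨e0, -, e2⟩ := eigenvector_iff.1 h
  rw [Fin.sum_univ_three] at hsum
  have z2 : ζ 2 = 0 := by
    have : (2 - goldenRatio) * ζ 2 = 0 := by linear_combination e2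
    exact (mul_eq_zero.1 this).resolve_left (by linarith)
  have z0 : ζ 0 = 2 - goldenRatio := by
    have e : (1 + goldenRatio) * ζ 0 = 1 := by linarith
    linear_combination (2 - goldenRatio) * e + ζ 0 * hsq
  funext i
  fin_cases i
  · simpa [goldenVector] using z0
  · simp [goldenVector]; linarith
  · simpa [goldenVector] using z2

theorem eq_tripleVector {ζ : Fin 3 → ℝ} (hsum : ∑ i, ζ i = 1)
    (h : ∀ w, ∑ v, (exampleMatrix v w : ℝ) * ζ v = 3 * ζ w) : ζ = tripleVector := by
  obtain ⟨e0, e1, -⟩ := eigenvector_iff.1 h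
  rw [Fin.sum_univ_three] at hsum
  funext i
  fin_cases i <;> simp [tripleVector] <;> linarith

variable {μ : Measure (PathSpace exampleMatrix)}

/-- The third coordinates vanish by domination. On the other two, `(1, 1 - φ)` is a left eigenvector
for `2 - φ`, the smaller eigenvalue of the golden block, so it annihilates `a n`, leaving multiples
of `(1, φ)`. -/
theorem HasCylinderValues.isErgodicInvariant_golden
    (h : HasCylinderValues (1 + goldenRatio) goldenVector μ) : IsErgodicInvariant μ := by
  have : IsProbabilityMeasure μ :=
    h.isProbabilityMeasure exampleMatrix_diag goldenVector_nonneg sum_goldenVector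
  have g1 := one_lt_goldenRatio
  have g2 := goldenRatio_lt_two
  have gsq := goldenRatio_sq
  have hlam : 0 < 1 + goldenRatio := by linarith
  refine isErgodicInvariant_of_proportional exampleMatrix_diag h.isTailInvariant
    fun a ha hle hrec => ?_
  simp only [cylinderMeasure, h.measureReal goldenVector_nonneg hlam, vertex_loop] at hle ⊢
  simp only [sum_exampleMatrix_mul] at hrec
  have r0 : ∀ n, a n 0 = a (n + 1) 0 + a (n + 1) 1 := fun n => by simpa using hrec n 0
  have r1 : ∀ n, a n 1 = a (n + 1) 0 + 2 * a (n + 1) 1 + a (n + 1) 2 :=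
    fun n => by simpa using hrec n 1
  have z2 : ∀ n, a n 2 = 0 := fun n => le_antisymm (by simpa [goldenVector] using hle n 2) (ha n 2)
  have z1 : ∀ n, a n 0 + (1 - goldenRatio) * a n 1 = 0 := by
    refine eq_zero_of_decay (θ := 2 - goldenRatio) (C := 1) hlam (by linarith) (by linarith)
      (fun n => ?_) fun n => ?_
    · rw [r0 n, r1 n, z2 (n + 1)]
      linear_combination - a (n + 1) 1 * gsq
    · have l0 := hle n 0
      have l1 := hle n 1
      have hp := pow_pos hlam n
      simp only [goldenVector, Matrix.cons_val_zero, Matrix.cons_val_one] at l0 l1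
      rw [le_div_iff₀ hp] at l0 l1 ⊢
      have n0 := mul_nonneg (ha n 0) hp.le
      have n1 := mul_nonneg (ha n 1) hp.le
      have habs : ∀ u : ℝ, |u| * (1 + goldenRatio) ^ n = |u * (1 + goldenRatio) ^ n| := fun u => by
        rw [abs_mul, abs_of_pos hp]
      rw [habs, abs_le]
      constructor <;> nlinarith
  have z0 : ∀ n, a n 1 = goldenRatio * a n 0 := fun n => by
    linear_combination (- goldenRatio) * z1 n - a n 1 * gsq
  -- Here `1 + φ` is the inverse of `2 - φ`, the first coordinate of `goldenVector`.
  refine ⟨(1 + goldenRatio) * a 0 0, fun n => ?_⟩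
  have key : a n 0 = (1 + goldenRatio) * a 0 0 * (2 - goldenRatio) / (1 + goldenRatio) ^ n := by
    induction n with
    | zero =>
      rw [pow_zero, div_one]
      linear_combination a 0 0 * gsq
    | succ n ih =>
      have e : a n 0 = (1 + goldenRatio) * a (n + 1) 0 := by rw [r0, z0]; ring
      rw [pow_succ, ← div_div, ← ih, e, mul_div_cancel_left₀ _ hlam.ne']
  intro i
  fin_cases i
  · simp [goldenVector, key, mul_div_assoc]
  · simp only [goldenVector, Fin.mk_one, Matrix.cons_val_one, Matrix.cons_val_zero, z0, key]
    linear_combination (-(1 + goldenRatio) * a 0 0 / (1 + goldenRatio) ^ n) * gsq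
  · simp [goldenVector, z2]

/-- Both eigenvalues `1 + φ` and `1 + ψ` of the golden block are positive and less than `3`; their
two left eigenvectors annihilate `a n`, leaving multiples of `(1, 2, 1)`. -/
theorem HasCylinderValues.isErgodicInvariant_triple
    (h : HasCylinderValues 3 tripleVector μ) : IsErgodicInvariant μ := by
  have : IsProbabilityMeasure μ :=
    h.isProbabilityMeasure exampleMatrix_diag tripleVector_nonneg sum_tripleVector
  have g1 := one_lt_goldenRatio
  have g2 := goldenRatio_lt_two
  have c1 := neg_one_lt_goldenConj
  have c2 := goldenConj_neg
  have hlam : (0 : ℝ) < 3 := by norm_num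
  refine isErgodicInvariant_of_proportional exampleMatrix_diag h.isTailInvariant
    fun a ha hle hrec => ?_
  simp only [cylinderMeasure, h.measureReal tripleVector_nonneg hlam, vertex_loop] at hle ⊢
  simp only [sum_exampleMatrix_mul] at hrec
  have r0 : ∀ n, a n 0 = a (n + 1) 0 + a (n + 1) 1 := fun n => by simpa using hrec n 0
  have r1 : ∀ n, a n 1 = a (n + 1) 0 + 2 * a (n + 1) 1 + a (n + 1) 2 :=
    fun n => by simpa using hrec n 1
  have r2 : ∀ n, a n 2 = 3 * a (n + 1) 2 := fun n => by simpa using hrec n 2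
  -- For a root `t` of `t² = t + 1`, `(1, t, -(2t + 1))` is a left eigenvector with eigenvalue `1 +
  -- t`. The constant `10` is a generous bound.
  have hz : ∀ t : ℝ, t ^ 2 = t + 1 → -1 < t → t < 2 → ∀ n,
      a n 0 + t * a n 1 - (2 * t + 1) * a n 2 = 0 := by
    intro t ht t1 t2
    refine eq_zero_of_decay (θ := 1 + t) (C := 10) hlam (by linarith) (by linarith)
      (fun n => ?_) fun n => ?_
    · rw [r0 n, r1 n, r2 n]
      linear_combination (2 * a (n + 1) 2 - a (n + 1) 1) * ht
    · have l0 := hle n 0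
      have l1 := hle n 1
      have l2 := hle n 2
      have hp : (0 : ℝ) < 3 ^ n := by positivity
      simp only [tripleVector, Matrix.cons_val] at l0 l1 l2
      rw [le_div_iff₀ hp] at l0 l1 l2 ⊢
      have n0 := mul_nonneg (ha n 0) hp.le
      have n1 := mul_nonneg (ha n 1) hp.le
      have n2 := mul_nonneg (ha n 2) hp.le
      have habs : ∀ u : ℝ, |u| * 3 ^ n = |u * 3 ^ n| := fun u => by
        rw [abs_mul, abs_of_pos hp]
      rw [habs, abs_le]
      constructor <;> nlinarith
  have hφ := hz _ goldenRatio_sq (by linarith) g2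
  have hψ := hz _ goldenConj_sq c1 (by linarith)
  have z1 : ∀ n, a n 1 = 2 * a n 2 := fun n => by
    have e : (goldenRatio - goldenConj) * (a n 1 - 2 * a n 2) = 0 := by
      linear_combination hφ n - hψ n
    linarith [(mul_eq_zero.1 e).resolve_left (by linarith)]
  have z0 : ∀ n, a n 0 = a n 2 := fun n => by
    linear_combination hφ n - goldenRatio * z1 n
  refine ⟨4 * a 0 2, fun n => ?_⟩
  have key : a n 2 = a 0 2 / 3 ^ n := by
    induction n with
    | zero => simp
    | succ n ih => rw [pow_succ, ← div_div, ← ih]; linarith [r2 n]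
  intro i
  fin_cases i
  · simp only [tripleVector, Fin.zero_eta, Matrix.cons_val, z0, key]; ring
  · simp only [tripleVector, Fin.mk_one, Matrix.cons_val, z1, key]; ring
  · simp only [tripleVector, Fin.reduceFinMk, Matrix.cons_val, key]; ring

/-- The numbers `k / (4 * 3 ^ n)`. -/
def quarterTriadic : AddSubmonoid ℝ where
  carrier := {r | ∃ k n : ℕ, r = k / (4 * 3 ^ n)}
  zero_mem' := ⟨0, 0, by simp⟩
  add_mem' := by
    rintro _ _ ⟨k, n, rfl⟩ ⟨l, m, rfl⟩
    refine ⟨k * 3 ^ m + l * 3 ^ n, n + m, ?_⟩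
    push_cast
    field_simp
    ring

/-- Multiplicativity would make `1/16` a clopen value, hence equal to some `k / (4 * 3 ^ n)`; then
`3 ^ n = 4 * k`, contradicting parity. -/
theorem HasCylinderValues.not_isBernoulliType_triple
    (h : HasCylinderValues 3 tripleVector μ) : ¬ IsBernoulliType (onSupport μ) := by
  intro hB
  have : IsProbabilityMeasure μ :=
    h.isProbabilityMeasure exampleMatrix_diag tripleVector_nonneg sum_tripleVector
  have hval := h.measureReal tripleVector_nonneg (by norm_num)
  have h4 : (1 / 4 : ℝ) ∈ clopenValues (onSupport μ) := by
    rw [clopenValues_onSupport]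
    refine ⟨_, isClopen_cylinder (loop exampleMatrix_diag 0) 0, ?_⟩
    rw [hval]
    simp [tripleVector]
  have h16 := hB.mul_mem h4 h4
  rw [clopenValues_onSupport] at h16
  obtain ⟨U, hU, hUr⟩ := h16
  have hmem : μ.real U ∈ quarterTriadic := by
    refine measureReal_mem_of_isClopen _ (fun x n => ?_) hU
    rw [hval]
    generalize x.vertex n = i
    fin_cases i
    · exact ⟨1, n, by simp [tripleVector]; ring⟩
    · exact ⟨2, n, by simp [tripleVector]; ring⟩
    · exact ⟨1, n, by simp [tripleVector]; ring⟩
  obtain ⟨k, n, hk⟩ := hmem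
  rw [← hUr] at hk
  field_simp at hk
  have hk' : 3 ^ n = 4 * k := by
    have : ((3 ^ n : ℕ) : ℝ) = ((4 * k : ℕ) : ℝ) := by push_cast; linarith
    exact_mod_cast this
  have hodd : Odd (3 ^ n) := Odd.pow (by decide)
  rw [hk'] at hodd
  exact (Nat.not_odd_iff_even.2 ⟨2 * k, by ring⟩) hodd

end Example

end Bratteli

/-! ### The golden measure: clopen values and Bernoulli type -/

namespace Bratteli

open PathSpace CantorMeasure

section Golden

open Real

/-- The ring `ℤ[φ]`, as an additive submonoid of the reals. -/
def goldenIntegers : AddSubmonoid ℝ where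
  carrier := {r | ∃ p q : ℤ, r = p + q * goldenRatio}
  zero_mem' := ⟨0, 0, by simp⟩
  add_mem' := by
    rintro _ _ ⟨p, q, rfl⟩ ⟨p', q', rfl⟩
    exact ⟨p + p', q + q', by push_cast; ring⟩

theorem mul_goldenRatio_mem {r : ℝ} (h : r ∈ goldenIntegers) : r * goldenRatio ∈ goldenIntegers := by
  obtain ⟨p, q, rfl⟩ := h
  exact ⟨q, p + q, by push_cast; linear_combination (q : ℝ) * goldenRatio_sq⟩

theorem div_goldenRatio_mem {r : ℝ} (h : r ∈ goldenIntegers) : r / goldenRatio ∈ goldenIntegers := by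
  obtain ⟨p, q, rfl⟩ := h
  refine ⟨q - p, p, ?_⟩
  rw [div_eq_iff goldenRatio_ne_zero]
  push_cast
  linear_combination (-p : ℝ) * goldenRatio_sq

theorem mul_goldenRatio_pow_mem {r : ℝ} (h : r ∈ goldenIntegers) (k : ℕ) :
    r * goldenRatio ^ k ∈ goldenIntegers := by
  induction k with
  | zero => simpa using h
  | succ k ih => rw [pow_succ, ← mul_assoc]; exact mul_goldenRatio_mem ih

theorem div_goldenRatio_pow_mem {r : ℝ} (h : r ∈ goldenIntegers) (k : ℕ) :
    r / goldenRatio ^ k ∈ goldenIntegers := by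
  induction k with
  | zero => simpa using h
  | succ k ih => rw [pow_succ, ← div_div]; exact div_goldenRatio_mem ih

theorem one_mem_goldenIntegers : (1 : ℝ) ∈ goldenIntegers := ⟨1, 0, by simp⟩

/-- The action of the upper left block of the incidence matrix on pairs of integers. -/
def goldenStep : ℤ × ℤ →+ ℤ × ℤ :=
  AddMonoidHom.mk' (fun v => (v.1 + v.2, v.1 + 2 * v.2)) fun v w => by
    ext <;> simp <;> ring

theorem goldenStep_apply (v : ℤ × ℤ) : goldenStep v = (v.1 + v.2, v.1 + 2 * v.2) := rfl

/-- The pairing of a pair of integers with the vector `(2 - t, t - 1)`. -/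
def goldenPairing (t : ℝ) (v : ℤ × ℤ) : ℝ := v.1 * (2 - t) + v.2 * (t - 1)

theorem goldenPairing_sub (t : ℝ) (v w : ℤ × ℤ) :
    goldenPairing t (v - w) = goldenPairing t v - goldenPairing t w := by
  simp [goldenPairing]; ring

/-- For either root `t`, `(2 - t, t - 1)` is an eigenvector of the symmetric golden block for `1 +
t`. The pairing at `φ` gives measures; the one at the conjugate controls the coordinates. -/
theorem goldenPairing_iterate {t : ℝ} (ht : t ^ 2 = t + 1) (v : ℤ × ℤ) (k : ℕ) :
    goldenPairing t (goldenStep^[k] v) = (1 + t) ^ k * goldenPairing t v := by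
  induction k generalizing v with
  | zero => simp
  | succ k ih =>
    rw [Function.iterate_succ_apply, ih, pow_succ, mul_assoc]
    congr 1
    simp only [goldenPairing, goldenStep_apply]
    push_cast
    linear_combination ((v.1 : ℝ) - v.2) * ht

/-- A pair of integers with positive pairing becomes nonnegative under iteration. -/
theorem eventually_nonneg_iterate {v : ℤ × ℤ} (hv : 0 < goldenPairing goldenRatio v) :
    ∀ᶠ k : ℕ in Filter.atTop, 0 ≤ goldenStep^[k] v := by
  have g1 := one_lt_goldenRatio
  have c1 := neg_one_lt_goldenConj
  have c2 := goldenConj_neg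
  have hsum := goldenRatio_add_goldenConj
  have hlim := (tendsto_pow_atTop_atTop_of_one_lt
    (show 1 < 1 + goldenRatio by linarith)).atTop_mul_const hv
  -- The pairing at `φ` grows without bound, while the conjugate one stays bounded because `0 < 1 +
  -- ψ < 1`.
  filter_upwards [hlim.eventually_ge_atTop |goldenPairing goldenConj v|] with k hk
  rw [← goldenPairing_iterate goldenRatio_sq] at hk
  have hy : |goldenPairing goldenConj (goldenStep^[k] v)| ≤ |goldenPairing goldenConj v| := by
    rw [goldenPairing_iterate goldenConj_sq, abs_mul, abs_pow]
    refine mul_le_of_le_one_left (abs_nonneg _) (pow_le_one₀ (abs_nonneg _) ?_)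
    rw [abs_of_pos] <;> linarith
  obtain ⟨h1, h2⟩ := abs_le.1 (hy.trans hk)
  have hx : 0 ≤ goldenPairing goldenRatio (goldenStep^[k] v) := (abs_nonneg _).trans (hy.trans hk)
  generalize goldenStep^[k] v = w at h1 h2 hx
  -- Solving for the coordinates from both pairings: the `φ` term dominates.
  have e1 : (goldenRatio - goldenConj) * w.1 = goldenRatio * goldenPairing goldenRatio w -
      goldenConj * goldenPairing goldenConj w := by
    simp only [goldenPairing]
    linear_combination (w.1 - w.2 : ℝ) * (goldenRatio_sq - goldenConj_sq)
  have e2 : (goldenRatio - goldenConj) * w.2 = (1 + goldenRatio) * goldenPairing goldenRatio w -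
      (1 + goldenConj) * goldenPairing goldenConj w := by
    simp only [goldenPairing]
    linear_combination (w.1 - w.2 : ℝ) * (goldenRatio_sq - goldenConj_sq)
  have hpos : 0 < goldenRatio - goldenConj := by linarith
  constructor
  · have : (0 : ℝ) ≤ w.1 := nonneg_of_mul_nonneg_right (by rw [e1]; nlinarith) hpos
    exact_mod_cast this
  · have : (0 : ℝ) ≤ w.2 := nonneg_of_mul_nonneg_right (by rw [e2]; nlinarith) hpos
    exact_mod_cast this

variable {μ : Measure (PathSpace exampleMatrix)}

/-- All the measures given by pairs of integers between `0` and `c` at level `n + 1` are realized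
by clopen subsets of `D`. -/
def Realizes (μ : Measure (PathSpace exampleMatrix)) (D : Set (PathSpace exampleMatrix)) (n : ℕ)
    (c : ℤ × ℤ) : Prop :=
  ∀ v : ℤ × ℤ, 0 ≤ v → v ≤ c → ∃ V : Set (PathSpace exampleMatrix), IsClopen V ∧ V ⊆ D ∧
    μ.real V = goldenPairing goldenRatio v / (1 + goldenRatio) ^ n

theorem Realizes.mono {D D' : Set (PathSpace exampleMatrix)} {n : ℕ} {c : ℤ × ℤ}
    (h : Realizes μ D n c) (hD : D ⊆ D') : Realizes μ D' n c := fun v hv hvc => by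
  obtain ⟨V, hV, hVD, hμ⟩ := h v hv hvc
  exact ⟨V, hV, hVD.trans hD, hμ⟩

/-- Realize `v ⊓ c` in the first set and the remainder, which is at most `c'`, in the second. -/
theorem Realizes.union [IsFiniteMeasure μ] {D D' : Set (PathSpace exampleMatrix)} {n : ℕ}
    {c c' : ℤ × ℤ} (h : Realizes μ D n c) (h' : Realizes μ D' n c') (hc : 0 ≤ c) (hc' : 0 ≤ c')
    (hd : Disjoint D D') : Realizes μ (D ∪ D') n (c + c') := fun v hv hvc => by
  obtain ⟨V, hV, hVD, hμ⟩ := h (v ⊓ c) (le_inf hv hc) inf_le_right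
  obtain ⟨V', hV', hVD', hμ'⟩ := h' (v - v ⊓ c) (sub_nonneg.2 inf_le_left) (by
    rw [sub_le_iff_le_add, add_comm, ← sub_le_iff_le_add]
    exact le_inf (sub_le_self _ hc') (sub_le_iff_le_add.2 hvc))
  refine ⟨V ∪ V', hV.union hV', Set.union_subset_union hVD hVD', ?_⟩
  rw [measureReal_union (hd.mono hVD hVD') hV'.isOpen.measurableSet, hμ, hμ', goldenPairing_sub]
  ring

variable (hμ : HasCylinderValues (1 + goldenRatio) goldenVector μ)
include hμ

theorem HasCylinderValues.measureReal_golden (x : PathSpace exampleMatrix) (n : ℕ) :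
    μ.real (x.cylinder n) = goldenVector (x.vertex n) / (1 + goldenRatio) ^ n :=
  hμ.measureReal goldenVector_nonneg (by linarith [one_lt_goldenRatio]) x n

theorem realizes_cylinder_zero {x : PathSpace exampleMatrix} {n : ℕ} (hx : x.vertex n = 0) :
    Realizes μ (x.cylinder n) n (1, 0) := by
  rintro ⟨p, q⟩ ⟨hp, hq⟩ ⟨hp', hq'⟩
  simp only [Prod.fst_zero, Prod.snd_zero] at hp hq hp' hq'
  obtain rfl : q = 0 := le_antisymm hq' hq
  rcases (show p = 0 ∨ p = 1 by omega) with rfl | rfl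
  · exact ⟨∅, isClopen_empty, Set.empty_subset _, by simp [goldenPairing]⟩
  · refine ⟨_, isClopen_cylinder x n, subset_rfl, ?_⟩
    rw [hμ.measureReal_golden, hx]
    simp [goldenPairing, goldenVector]

theorem realizes_cylinder_one {x : PathSpace exampleMatrix} {n : ℕ} (hx : x.vertex n = 1) :
    Realizes μ (x.cylinder n) n (0, 1) := by
  rintro ⟨p, q⟩ ⟨hp, hq⟩ ⟨hp', hq'⟩
  simp only [Prod.fst_zero, Prod.snd_zero] at hp hq hp' hq'
  obtain rfl : p = 0 := le_antisymm hp' hp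
  rcases (show q = 0 ∨ q = 1 by omega) with rfl | rfl
  · exact ⟨∅, isClopen_empty, Set.empty_subset _, by simp [goldenPairing]⟩
  · refine ⟨_, isClopen_cylinder x n, subset_rfl, ?_⟩
    rw [hμ.measureReal_golden, hx]
    simp [goldenPairing, goldenVector]

/-- The iterate counts subcylinders ending at vertices `0` and `1` after `k` more levels. The
induction splits by the first new edge; edges into the null vertex `2` are ignored. -/
theorem realizes_cylinder_iterate [IsFiniteMeasure μ] (k : ℕ) :
    (0 ≤ goldenStep^[k] (1, 0) ∧ ∀ (x : PathSpace exampleMatrix) (n : ℕ), x.vertex n = 0 →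
      Realizes μ (x.cylinder n) (n + k) (goldenStep^[k] (1, 0))) ∧
    (0 ≤ goldenStep^[k] (0, 1) ∧ ∀ (x : PathSpace exampleMatrix) (n : ℕ), x.vertex n = 1 →
      Realizes μ (x.cylinder n) (n + k) (goldenStep^[k] (0, 1))) := by
  induction k with
  | zero =>
    exact ⟨⟨by decide, fun x n hx => realizes_cylinder_zero hμ hx⟩,
      ⟨by decide, fun x n hx => realizes_cylinder_one hμ hx⟩⟩
  | succ k ih =>
    obtain ⟨⟨p0, h0⟩, p1, h1⟩ := ih
    have s0 : goldenStep^[k + 1] (1, 0) = goldenStep^[k] (1, 0) + goldenStep^[k] (0, 1) := by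
      rw [Function.iterate_succ_apply, ← iterate_map_add]
      rfl
    have s1 : goldenStep^[k + 1] (0, 1) =
        goldenStep^[k] (1, 0) + goldenStep^[k] (0, 1) + goldenStep^[k] (0, 1) := by
      rw [Function.iterate_succ_apply, ← iterate_map_add, ← iterate_map_add]
      rfl
    have hdisj : ∀ (x : PathSpace exampleMatrix) (n : ℕ) {e e' : Edge exampleMatrix}, e ≠ e' →
        Disjoint ({y | y.edge n = e} ∩ x.cylinder n) ({y | y.edge n = e'} ∩ x.cylinder n) :=
      fun x n e e' hne => Set.disjoint_left.2 fun y hy hy' => hne (hy.1.symm.trans hy'.1)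
    have c0 : ∀ (x : PathSpace exampleMatrix) (n : ℕ) (e : Edge exampleMatrix),
        e.source = x.vertex n → e.range = 0 →
        Realizes μ ({y | y.edge n = e} ∩ x.cylinder n) (n + (k + 1)) (goldenStep^[k] (1, 0)) := by
      intro x n e he her
      rw [cylinder_inter_edge exampleMatrix_diag _ _ _ he, add_comm k, ← add_assoc]
      exact h0 _ _ ((vertex_extend _ _ _ _ _).trans her)
    have c1 : ∀ (x : PathSpace exampleMatrix) (n : ℕ) (e : Edge exampleMatrix),
        e.source = x.vertex n → e.range = 1 →
        Realizes μ ({y | y.edge n = e} ∩ x.cylinder n) (n + (k + 1)) (goldenStep^[k] (0, 1)) := by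
      intro x n e he her
      rw [cylinder_inter_edge exampleMatrix_diag _ _ _ he, add_comm k, ← add_assoc]
      exact h1 _ _ ((vertex_extend _ _ _ _ _).trans her)
    refine ⟨⟨s0 ▸ add_nonneg p0 p1, fun x n hx => ?_⟩,
      ⟨s1 ▸ add_nonneg (add_nonneg p0 p1) p1, fun x n hx => ?_⟩⟩
    · rw [s0]
      let e : Edge exampleMatrix := ⟨0, 0, ⟨0, by decide⟩⟩
      let e' : Edge exampleMatrix := ⟨1, 0, ⟨0, by decide⟩⟩
      exact ((c0 x n e hx.symm rfl).union (c1 x n e' hx.symm rfl) p0 p1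
        (hdisj x n fun h => absurd (congrArg Edge.range h) (show (0 : Fin 3) ≠ 1 by decide))).mono
          (Set.union_subset Set.inter_subset_right Set.inter_subset_right)
    · rw [s1]
      let e : Edge exampleMatrix := ⟨0, 1, ⟨0, by decide⟩⟩
      let e' : Edge exampleMatrix := ⟨1, 1, ⟨0, by decide⟩⟩
      let e'' : Edge exampleMatrix := ⟨1, 1, ⟨1, by decide⟩⟩
      exact (((c0 x n e hx.symm rfl).union (c1 x n e' hx.symm rfl) p0 p1
        (hdisj x n fun h => absurd (congrArg Edge.range h) (show (0 : Fin 3) ≠ 1 by decide))).union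
          (c1 x n e'' hx.symm rfl) (add_nonneg p0 p1) p1
          (Disjoint.union_left
            (hdisj x n fun h => absurd (congrArg Edge.range h) (show (0 : Fin 3) ≠ 1 by decide))
            (hdisj x n fun h => absurd (congrArg (fun f : Edge exampleMatrix => (f.2.2 : ℕ)) h)
              (show 0 ≠ 1 by decide)))).mono
          (Set.union_subset (Set.union_subset Set.inter_subset_right Set.inter_subset_right)
            Set.inter_subset_right)

/-- A cylinder set of positive measure is given by the standard basis vectors. -/
theorem exists_realizes_of_vertex_ne [IsFiniteMeasure μ] {x : PathSpace exampleMatrix} {n : ℕ}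
    (hx : x.vertex n ≠ 2) : ∃ c : ℤ × ℤ,
      (∀ k, Realizes μ (x.cylinder n) (n + k) (goldenStep^[k] c)) ∧
      ∃ j : ℕ, goldenPairing goldenRatio c = 1 / goldenRatio ^ (j + 1) ∧
        μ.real (x.cylinder n) = 1 / goldenRatio ^ (j + 1) / (1 + goldenRatio) ^ n := by
  have hg := goldenRatio_sq
  have hg0 := goldenRatio_ne_zero
  -- Both nonzero coordinates of the eigenvector are inverse powers of `φ`, hence units of `ℤ[φ]`.
  have e0 : 2 - goldenRatio = 1 / goldenRatio ^ (1 + 1) := by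
    rw [eq_div_iff (by positivity)]
    linear_combination (1 - goldenRatio) * hg
  have e1 : goldenRatio - 1 = 1 / goldenRatio ^ (0 + 1) := by
    rw [eq_div_iff (by positivity)]
    linear_combination hg
  have hcases : x.vertex n = 0 ∨ x.vertex n = 1 := by omega
  rcases hcases with h | h
  · refine ⟨(1, 0), fun k => (realizes_cylinder_iterate hμ k).1.2 x n h, 1, ?_, ?_⟩
    · simp [goldenPairing, e0]
    · rw [hμ.measureReal_golden, h, ← e0]
      simp [goldenVector]
  · refine ⟨(0, 1), fun k => (realizes_cylinder_iterate hμ k).2.2 x n h, 0, ?_, ?_⟩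
    · simp [goldenPairing, e1]
    · rw [hμ.measureReal_golden, h, ← e1]
      simp [goldenVector]

/-- The relative clopen values of a cylinder set of positive measure include `ℤ[φ] ∩ [0, 1]`. -/
theorem exists_isClopen_subset_cylinder [IsFiniteMeasure μ] {x : PathSpace exampleMatrix} {n : ℕ}
    (hx : x.vertex n ≠ 2) {r : ℝ} (hr : r ∈ goldenIntegers) (h0 : 0 ≤ r) (h1 : r ≤ 1) :
    ∃ V : Set (PathSpace exampleMatrix), IsClopen V ∧ V ⊆ x.cylinder n ∧
      μ.real V = r * μ.real (x.cylinder n) := by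
  have hφ := goldenRatio_pos
  rcases h0.eq_or_lt with rfl | h0
  · exact ⟨∅, isClopen_empty, Set.empty_subset _, by simp⟩
  rcases h1.eq_or_lt with rfl | h1
  · exact ⟨_, isClopen_cylinder x n, subset_rfl, (one_mul _).symm⟩
  obtain ⟨c, hc, j, hcj, hμx⟩ := exists_realizes_of_vertex_ne hμ hx
  obtain ⟨p, q, hpq⟩ := div_goldenRatio_pow_mem hr (j + 1)
  -- The coordinates `(p + q, p + 2q)` are those of `p + qφ` in the basis `2 - φ, φ - 1` of `ℤ[φ]`.
  have hv : goldenPairing goldenRatio (p + q, p + 2 * q) = r * goldenPairing goldenRatio c := by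
    rw [hcj, mul_one_div, hpq]
    simp only [goldenPairing]
    push_cast
    ring
  have hcpos : 0 < goldenPairing goldenRatio c := by rw [hcj]; positivity
  -- As `0 < r < 1`, both the target vector and its difference from `c` have positive pairing, so at
  -- a deep level the target lies between `0` and the available count.
  obtain ⟨k, hk, hk'⟩ := ((eventually_nonneg_iterate (hv ▸ mul_pos h0 hcpos)).and
    (eventually_nonneg_iterate (v := c - (p + q, p + 2 * q)) (by
      rw [goldenPairing_sub, hv]; nlinarith))).exists
  rw [iterate_map_sub, sub_nonneg] at hk'
  obtain ⟨V, hV, hVx, hμV⟩ := hc k _ hk hk'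
  refine ⟨V, hV, hVx, ?_⟩
  rw [hμV, goldenPairing_iterate goldenRatio_sq, hv, hμx, hcj, pow_add]
  have : 1 + goldenRatio ≠ 0 := by positivity
  field_simp
  ring

theorem HasCylinderValues.measureReal_mem_goldenIntegers [IsFiniteMeasure μ]
    {U : Set (PathSpace exampleMatrix)} (hU : IsClopen U) : μ.real U ∈ goldenIntegers := by
  refine measureReal_mem_of_isClopen _ (fun x n => ?_) hU
  by_cases hx : x.vertex n = 2
  · rw [hμ.measureReal_golden, hx]
    simp [goldenVector, zero_mem]
  · obtain ⟨-, -, j, -, h⟩ := exists_realizes_of_vertex_ne hμ hx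
    rw [h, add_comm 1, ← goldenRatio_sq, ← pow_mul]
    exact div_goldenRatio_pow_mem (div_goldenRatio_pow_mem one_mem_goldenIntegers _) _

theorem HasCylinderValues.mem_clopenValues_golden [IsProbabilityMeasure μ] {r : ℝ} :
    r ∈ clopenValues μ ↔ r ∈ goldenIntegers ∧ 0 ≤ r ∧ r ≤ 1 := by
  constructor
  · rintro ⟨U, hU, rfl⟩
    exact ⟨hμ.measureReal_mem_goldenIntegers hU, measureReal_nonneg, measureReal_le_one⟩
  · rintro ⟨hr, h0, h1⟩
    have g1 := one_lt_goldenRatio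
    have g2 := goldenRatio_lt_two
    have gsq := goldenRatio_sq
    let x : Fin 3 → PathSpace exampleMatrix := loop exampleMatrix_diag
    have m0 : μ.real ((x 0).cylinder 0) = 2 - goldenRatio := by
      rw [hμ.measureReal_golden, vertex_loop]; simp [goldenVector]
    have m1 : μ.real ((x 1).cylinder 0) = goldenRatio - 1 := by
      rw [hμ.measureReal_golden, vertex_loop]; simp [goldenVector]
    -- The level-one cylinders at `0` and `1`, of measures `φ⁻²` and `φ⁻¹`, carry all the mass: a
    -- small `r` fits in the first; otherwise take all of it and put the rest in the second.
    rcases le_total r (2 - goldenRatio) with h | h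
    · obtain ⟨V, hV, -, hμV⟩ := exists_isClopen_subset_cylinder hμ (x := x 0) (n := 0)
        (r := r * goldenRatio ^ 2) (by rw [vertex_loop]; decide) (mul_goldenRatio_pow_mem hr 2)
        (by positivity) (by nlinarith)
      refine ⟨V, hV, ?_⟩
      rw [hμV, m0]
      linear_combination r * (goldenRatio - 1) * gsq
    · have hr' : r - (2 - goldenRatio) ∈ goldenIntegers := by
        obtain ⟨p, q, rfl⟩ := hr
        exact ⟨p - 2, q + 1, by push_cast; ring⟩
      obtain ⟨V, hV, hVx, hμV⟩ := exists_isClopen_subset_cylinder hμ (x := x 1) (n := 0)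
        (by rw [vertex_loop]; decide) (mul_goldenRatio_mem hr')
        (mul_nonneg (by linarith) (by linarith)) (by nlinarith)
      have hd : Disjoint ((x 0).cylinder 0) V := by
        refine Set.disjoint_left.2 fun y hy hy' => ?_
        have e := (vertex_eq_of_mem hy).symm.trans (vertex_eq_of_mem (hVx hy'))
        rw [vertex_loop, vertex_loop] at e
        exact absurd e (by decide)
      refine ⟨_, (isClopen_cylinder (x 0) 0).union hV, ?_⟩
      rw [measureReal_union hd hV.isOpen.measurableSet, hμV, m0, m1]
      linear_combination -(r - (2 - goldenRatio)) * gsq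

/-- Dividing by the measure of a non-null cylinder set, a unit of `ℤ[φ]`, keeps values in `ℤ[φ]`;
`exists_isClopen_subset_cylinder` gives the converse. -/
theorem HasCylinderValues.isBernoulliType_golden : IsBernoulliType (onSupport μ) := by
  have : IsProbabilityMeasure μ :=
    hμ.isProbabilityMeasure exampleMatrix_diag goldenVector_nonneg sum_goldenVector
  have hφ := goldenRatio_pos
  refine isBernoulliType_onSupport μ fun x n hpos r => ?_
  have hx : x.vertex n ≠ 2 := fun h => hpos (by rw [hμ, h]; simp [goldenVector])
  rw [hμ.mem_clopenValues_golden]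
  obtain ⟨-, -, j, -, hval⟩ := exists_realizes_of_vertex_ne hμ hx
  rw [add_comm 1, ← goldenRatio_sq, ← pow_mul] at hval
  have hpos' : 0 < μ.real (x.cylinder n) := by rw [hval]; positivity
  constructor
  · rintro ⟨V, hV, hVx, rfl⟩
    refine ⟨?_, by positivity, (div_le_one hpos').2 (measureReal_mono hVx)⟩
    rw [hval, div_div, div_div_eq_mul_div, div_one, ← pow_add]
    exact mul_goldenRatio_pow_mem (hμ.measureReal_mem_goldenIntegers hV) _
  · rintro ⟨hr, h0, h1⟩
    obtain ⟨V, hV, hVx, hμV⟩ := exists_isClopen_subset_cylinder hμ hx hr h0 h1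
    exact ⟨V, hV, hVx, by rw [hμV, mul_div_cancel_right₀ _ hpos'.ne']⟩

end Golden

end Bratteli

theorem mainTheorem10 :
    (∃! μ₁ : Measure (Bratteli.PathSpace exampleMatrix),
        Bratteli.IsDefinedByEigenvalue ((3 + Real.sqrt 5) / 2) μ₁) ∧
    (∃! μ₂ : Measure (Bratteli.PathSpace exampleMatrix),
        Bratteli.IsDefinedByEigenvalue 3 μ₂) ∧
    (∀ μ₁ : Measure (Bratteli.PathSpace exampleMatrix),
        Bratteli.IsDefinedByEigenvalue ((3 + Real.sqrt 5) / 2) μ₁ →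
          Bratteli.IsErgodicInvariant μ₁ ∧
          CantorMeasure.IsBernoulliType (CantorMeasure.onSupport μ₁)) ∧
    (∀ μ₂ : Measure (Bratteli.PathSpace exampleMatrix),
        Bratteli.IsDefinedByEigenvalue 3 μ₂ →
          Bratteli.IsErgodicInvariant μ₂ ∧
          ¬ CantorMeasure.IsBernoulliType (CantorMeasure.onSupport μ₂)) := by
  have hlam : (3 + Real.sqrt 5) / 2 = 1 + Real.goldenRatio := by
    rw [Real.goldenRatio]; ring
  rw [hlam]
  obtain ⟨u₁, v₁⟩ := Bratteli.existsUnique_isDefinedByEigenvalue Bratteli.exampleMatrix_diag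
    (by linarith [Real.one_lt_goldenRatio]) Bratteli.goldenVector_nonneg Bratteli.sum_goldenVector
    Bratteli.goldenVector_eigenvector fun _ => Bratteli.eq_goldenVector
  obtain ⟨u₂, v₂⟩ := Bratteli.existsUnique_isDefinedByEigenvalue Bratteli.exampleMatrix_diag
    (by norm_num) Bratteli.tripleVector_nonneg Bratteli.sum_tripleVector
    Bratteli.tripleVector_eigenvector fun _ => Bratteli.eq_tripleVector
  exact ⟨u₁, u₂,
    fun μ hμ => ⟨(v₁ μ hμ).isErgodicInvariant_golden, (v₁ μ hμ).isBernoulliType_golden⟩,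
    fun μ hμ => ⟨(v₂ μ hμ).isErgodicInvariant_triple, (v₂ μ hμ).not_isBernoulliType_triple⟩⟩
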